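/- Let $n\ge 2$ and let $\Omega\subset\mathbb R^n$ be a smooth bounded domain (open, connected) whose boundary is the union $\partial\Omega=\Gamma_D\cup\Gamma_N$ of two disjoint, closed, connected, non-empty sets. For $v\in H^1(\Omega)$, $v\not\equiv 0$, put $$\mathcal R(v)=\frac{\int_\Omega|\nabla v|^2\,dx}{\int_\Omega v^2\,dx},\qquad \mathcal C=\{v\in H^1(\Omega): v|_{\Gamma_D}=0\},$$ and write $\|\cdot\|_2$ for the norm of $L^2(\Omega)$. Let $u_0\in C^1(\Omega)\cap L^\infty(\Omega)$ be strictly positive in $\Omega$, with $\nabla u_0\in L^2(\Omega)$ and $\mathcal R(u_0)>0$, and for each $k\ge 0$ let $u_{k+1}\in C^2(\Omega)\cap C^1(\overline\Omega)$ be a classical solution of $$-\Delta u_{k+1}=\mathcal R(u_k)\,u_k\ \text{ in }\Omega,\qquad u_{k+1}=0\ \text{ on }\Gamma_D,\qquad \partial_\nu u_{k+1}=0\ \text{ on }\Gamma_N .$$ Then: 1. $\|u_k\|_2>0$ for every $k\ge 0$ (so that all the Rayleigh quotients are well defined), and for every $k\ge 0$ $$\mathcal R(u_{k+1})\,\|u_{k+1}\|_2\le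 \mathcal R(u_k)\,\|u_k\|_2 .$$ 2. For every $k\ge 1$, and also for $k=0$ if $u_0\in\mathcal C$, $$\|\nabla u_{k+1}\|_2\ge\|\nabla u_k\|_2,\qquad \|u_{k+1}\|_2\ge\|u_k\|_2,\qquad \mathcal R(u_{k+1})\le\mathcal R(u_k).$$ 3. The sequence $(u_k)_{k\ge 0}$ is bounded in $H^1(\Omega)$: there is a constant $M$ with $\left(\|u_k\|_2^2+\|\nabla u_k\|_2^2\right)^{1/2}\le M$ for all $k$. -/

import Mathlib

open MeasureTheory Set
open scoped ContDiff

noncomputable section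

/-- Near `x`, and after a rotation that sends the unit vector `e` to the last coordinate direction,
`Ω` is the region below the graph of the smooth function `γ`. That `γ` is a function of the
coordinates orthogonal to `e` is expressed by its invariance under translations along `e`. -/
structure IsBoundaryChart {n : ℕ} (Ω : Set (EuclideanSpace ℝ (Fin n)))
    (x : EuclideanSpace ℝ (Fin n)) (r : ℝ) (e : EuclideanSpace ℝ (Fin n))
    (γ : EuclideanSpace ℝ (Fin n) → ℝ) : Prop where
  radius_pos : 0 < r
  norm_dir : ‖e‖ = 1
  smooth : ContDiff ℝ ∞ γ
  invariant : ∀ (y : EuclideanSpace ℝ (Fin n)) (t : ℝ), γ (y + t • e) = γ y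
  mem_iff : ∀ y ∈ Metric.ball x r, y ∈ Ω ↔ inner ℝ e y < γ y

/-- A smooth bounded domain of `ℝⁿ`: open, connected (and non-empty), bounded, and near each
boundary point lying on one side of a smooth graph. -/
structure IsSmoothBoundedDomain {n : ℕ} (Ω : Set (EuclideanSpace ℝ (Fin n))) : Prop where
  isOpen : IsOpen Ω
  isConnected : IsConnected Ω
  isBounded : Bornology.IsBounded Ω
  smooth_boundary : ∀ x ∈ frontier Ω, ∃ r e γ, IsBoundaryChart Ω x r e γ

/-- `ν` is the outward unit normal of `Ω` at the boundary point `x`: near `x` the set `Ω` is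
`{y | ⟪e, y⟫ - γ y < 0}`, and `ν` is the normalised gradient of `y ↦ ⟪e, y⟫ - γ y` at `x`. -/
def IsOutwardUnitNormal {n : ℕ} (Ω : Set (EuclideanSpace ℝ (Fin n)))
    (x ν : EuclideanSpace ℝ (Fin n)) : Prop :=
  x ∈ frontier Ω ∧ ∃ r e γ, IsBoundaryChart Ω x r e γ ∧
    ν = ‖e - gradient γ x‖⁻¹ • (e - gradient γ x)

/-- The boundary of `Ω` is the union of two disjoint closed connected (non-empty) sets. -/
structure IsBoundarySplitting {n : ℕ} (Ω ΓD ΓN : Set (EuclideanSpace ℝ (Fin n))) : Prop where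
  union_eq : frontier Ω = ΓD ∪ ΓN
  disjoint : Disjoint ΓD ΓN
  isClosed_left : IsClosed ΓD
  isClosed_right : IsClosed ΓN
  isConnected_left : IsConnected ΓD
  isConnected_right : IsConnected ΓN

/-- `v ∈ C²(Ω) ∩ C¹(closure Ω)` is a classical solution of `-Δ v = f` in `Ω`, `v = 0` on `ΓD`,
`∂_ν v = 0` on `ΓN`. The field `G` is the continuous extension of `∇ v` to the closure of `Ω`; it
supplies the gradient at boundary points. -/
def IsClassicalMixedSolution {n : ℕ} (Ω ΓD ΓN : Set (EuclideanSpace ℝ (Fin n)))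
    (f v : EuclideanSpace ℝ (Fin n) → ℝ) : Prop :=
  ContDiffOn ℝ 2 v Ω ∧ ContinuousOn v (closure Ω) ∧
  (∀ x ∈ Ω, -(Laplacian.laplacian v x) = f x) ∧
  (∀ x ∈ ΓD, v x = 0) ∧
  ∃ G : EuclideanSpace ℝ (Fin n) → EuclideanSpace ℝ (Fin n),
    ContinuousOn G (closure Ω) ∧ (∀ x ∈ Ω, G x = gradient v x) ∧
    ∀ x ∈ ΓN, ∀ ν, IsOutwardUnitNormal Ω x ν → inner ℝ (G x) ν = 0

/-- `‖v‖₂`, the norm of `L²(Ω)`. -/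
def normL2 {n : ℕ} (Ω : Set (EuclideanSpace ℝ (Fin n))) (v : EuclideanSpace ℝ (Fin n) → ℝ) : ℝ :=
  √(∫ x in Ω, v x ^ 2)

/-- `‖∇ v‖₂`, for `v` of class `C¹` in `Ω`. -/
def normGradL2 {n : ℕ} (Ω : Set (EuclideanSpace ℝ (Fin n)))
    (v : EuclideanSpace ℝ (Fin n) → ℝ) : ℝ :=
  √(∫ x in Ω, ‖gradient v x‖ ^ 2)

/-- The Rayleigh quotient `∫_Ω |∇ v|² / ∫_Ω v²`. -/
def rayleigh {n : ℕ} (Ω : Set (EuclideanSpace ℝ (Fin n)))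
    (v : EuclideanSpace ℝ (Fin n) → ℝ) : ℝ :=
  (∫ x in Ω, ‖gradient v x‖ ^ 2) / ∫ x in Ω, v x ^ 2

/-- `v` and `∇ v` are square integrable on `Ω`: a function of class `C¹` in `Ω` satisfies this if
and only if it belongs to `H¹(Ω)`. -/
def HasFiniteH1Norm {n : ℕ} (Ω : Set (EuclideanSpace ℝ (Fin n)))
    (v : EuclideanSpace ℝ (Fin n) → ℝ) : Prop :=
  MemLp v 2 (volume.restrict Ω) ∧ MemLp (gradient v) 2 (volume.restrict Ω)

/-- `‖v‖_{H¹(Ω)}`, for `v` of class `C¹` in `Ω`. -/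
def normH1 {n : ℕ} (Ω : Set (EuclideanSpace ℝ (Fin n))) (v : EuclideanSpace ℝ (Fin n) → ℝ) : ℝ :=
  √((∫ x in Ω, v x ^ 2) + ∫ x in Ω, ‖gradient v x‖ ^ 2)

/-- For `v` of class `C¹` in `Ω`: `v` belongs to the space of the functions of `H¹(Ω)` that vanish
on `ΓD`, that is, `v` has finite `H¹` norm and is a limit in `H¹(Ω)` of smooth functions whose
supports do not meet `ΓD`. -/
def VanishesOnDirichletPart {n : ℕ} (Ω ΓD : Set (EuclideanSpace ℝ (Fin n)))
    (v : EuclideanSpace ℝ (Fin n) → ℝ) : Prop :=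
  HasFiniteH1Norm Ω v ∧
  ∀ ε > 0, ∃ φ : EuclideanSpace ℝ (Fin n) → ℝ,
    ContDiff ℝ ∞ φ ∧ HasCompactSupport φ ∧ Disjoint (tsupport φ) ΓD ∧
    (∫ x in Ω, (φ x - v x) ^ 2) + (∫ x in Ω, ‖gradient φ x - gradient v x‖ ^ 2) < ε

end

open Filter Topology
open scoped ENNReal

noncomputable section

/-! Write `R_k` for the Rayleigh quotient of `u k`. Everything follows from the weak form `∫
∇u_{k+1} · ∇φ = R_k ∫ u_k φ`. Testing with `φ = u_{k+1}` and Cauchy-Schwarz give `‖∇u_{k+1}‖² ≤ R_k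
‖u_k‖ ‖u_{k+1}‖`, and dividing by `‖u_{k+1}‖` shows that `R_k ‖u_k‖` decreases. When `u_k` itself is
admissible, testing with it gives `‖∇u_k‖² ≤ ‖∇u_{k+1}‖ ‖∇u_k‖`, so the energy increases; combined
with the first estimate this yields the growth of the norm and the decay of the quotient. Finally,
the Poincaré inequality `‖v‖² ≤ C ‖∇v‖²` for `v = u_{k+1}` reads `‖v‖ ≤ C (R_{k+1} ‖v‖)`, and the
bracket is bounded by its initial value; this also bounds `‖∇v‖² = (R_{k+1} ‖v‖) ‖v‖`.

Two analytic facts carry this. The weak form comes from `integral_divergence_eq_zero`, a divergence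
theorem without boundary term: for `F = φ ∇v` the flux vanishes on `ΓD` because of `φ` and on `ΓN`
because of `∇v`, so no surface measure is needed. The Poincaré inequality (`exists_poincare`) is
obtained directly: integrate along the chart direction near `ΓD`, propagate by translations through
the connected set `Ω` and up to its boundary, and conclude by compactness. -/

/-- The divergence of a vector field on `ℝⁿ`. -/
def divergence {n : ℕ} (F : EuclideanSpace ℝ (Fin n) → EuclideanSpace ℝ (Fin n))
    (x : EuclideanSpace ℝ (Fin n)) : ℝ :=
  ∑ i, fderiv ℝ F x (EuclideanSpace.single i 1) i

/-! ### Integration by parts with compact support -/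

theorem integral_fderiv_apply_eq_zero {n : ℕ} {g : EuclideanSpace ℝ (Fin n) → ℝ}
    (hg : ContDiff ℝ 1 g) (hc : HasCompactSupport g) (v : EuclideanSpace ℝ (Fin n)) :
    ∫ x, fderiv ℝ g x v = 0 := by
  have hcont : Continuous fun x => fderiv ℝ g x v :=
    (hg.continuous_fderiv one_ne_zero).clm_apply continuous_const
  have h := integral_mul_fderiv_eq_neg_fderiv_mul_of_integrable (μ := volume) (𝕜 := ℝ)
    (f := fun _ : EuclideanSpace ℝ (Fin n) => (1 : ℝ)) (g := g) (v := v) (by simp)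
    (by simpa using hcont.integrable_of_hasCompactSupport (hc.fderiv_apply (𝕜 := ℝ) v))
    (by simpa using hg.continuous.integrable_of_hasCompactSupport hc)
    (fun x _ => differentiableAt_const _) (fun x _ => hg.differentiable one_ne_zero x)
  simpa using h

/-- Nothing is known of `f` outside `Ω`, but near a point outside `Ω` the factor `ψ` vanishes
identically. -/
theorem ContDiff.mul_of_tsupport_subset {E : Type*} [NormedAddCommGroup E] [NormedSpace ℝ E]
    {Ω : Set E} (hΩ : IsOpen Ω) {ψ f : E → ℝ} {m : WithTop ℕ∞} (hψ : ContDiff ℝ m ψ)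
    (hs : tsupport ψ ⊆ Ω) (hf : ContDiffOn ℝ m f Ω) : ContDiff ℝ m fun x => ψ x * f x := by
  rw [contDiff_iff_contDiffAt]
  intro x
  by_cases hx : x ∈ Ω
  · exact hψ.contDiffAt.mul (hf.contDiffAt (hΩ.mem_nhds hx))
  · have h0 : ψ =ᶠ[𝓝 x] 0 := notMem_tsupport_iff_eventuallyEq.1 fun h => hx (hs h)
    have : (fun x => ψ x * f x) =ᶠ[𝓝 x] fun _ => 0 := by
      filter_upwards [h0] with y hy
      simp [hy]
    exact contDiffAt_const.congr_of_eventuallyEq this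

theorem fderiv_apply_eq_sum {n : ℕ} (L : EuclideanSpace ℝ (Fin n) →L[ℝ] ℝ)
    (w : EuclideanSpace ℝ (Fin n)) : L w = ∑ i, L (EuclideanSpace.single i 1) * w i := by
  conv_lhs => rw [← (EuclideanSpace.basisFun (Fin n) ℝ).sum_repr w]
  simp [mul_comm]

theorem divergence_mul_eq {n : ℕ} {ψ : EuclideanSpace ℝ (Fin n) → ℝ}
    {F : EuclideanSpace ℝ (Fin n) → EuclideanSpace ℝ (Fin n)} {x : EuclideanSpace ℝ (Fin n)}
    (hψ : DifferentiableAt ℝ ψ x) (hF : DifferentiableAt ℝ F x) :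
    ∑ i, fderiv ℝ (fun y => ψ y * F y i) x (EuclideanSpace.single i 1) =
      fderiv ℝ ψ x (F x) + ψ x * divergence F x := by
  have hcoord (i : Fin n) : HasFDerivAt (fun y => F y i)
      ((EuclideanSpace.proj i : EuclideanSpace ℝ (Fin n) →L[ℝ] ℝ).comp (fderiv ℝ F x)) x :=
    (EuclideanSpace.proj i : EuclideanSpace ℝ (Fin n) →L[ℝ] ℝ).hasFDerivAt.comp x hF.hasFDerivAt
  rw [fderiv_apply_eq_sum (fderiv ℝ ψ x), divergence, Finset.mul_sum, ← Finset.sum_add_distrib]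
  refine Finset.sum_congr rfl fun i _ => ?_
  rw [(hψ.hasFDerivAt.fun_mul (hcoord i)).fderiv]
  simp
  ring

/-- Integration by parts against a test function with compact support in `Ω`. -/
theorem integral_divergence_of_tsupport_subset {n : ℕ} {Ω : Set (EuclideanSpace ℝ (Fin n))}
    (hΩ : IsOpen Ω) {F : EuclideanSpace ℝ (Fin n) → EuclideanSpace ℝ (Fin n)}
    (hF : ContDiffOn ℝ 1 F Ω) {ψ : EuclideanSpace ℝ (Fin n) → ℝ} (hψ : ContDiff ℝ 1 ψ)
    (hc : HasCompactSupport ψ) (hs : tsupport ψ ⊆ Ω) :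
    ∫ x in Ω, (fderiv ℝ ψ x (F x) + ψ x * divergence F x) = 0 := by
  have hcoord (i : Fin n) : ContDiff ℝ 1 fun x => ψ x * F x i :=
    hψ.mul_of_tsupport_subset hΩ hs
      ((EuclideanSpace.proj i : EuclideanSpace ℝ (Fin n) →L[ℝ] ℝ).contDiff.comp_contDiffOn hF)
  have hcc (i : Fin n) : HasCompactSupport fun x => ψ x * F x i := hc.mul_right
  have hzero : ∫ x, ∑ i, fderiv ℝ (fun y => ψ y * F y i) x (EuclideanSpace.single i 1) = 0 := by
    rw [integral_finsetSum]
    · exact Finset.sum_eq_zero fun i _ => integral_fderiv_apply_eq_zero (hcoord i) (hcc i) _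
    · intro i _
      exact (((hcoord i).continuous_fderiv one_ne_zero).clm_apply
        continuous_const).integrable_of_hasCompactSupport ((hcc i).fderiv_apply (𝕜 := ℝ) _)
  have hout : ∫ x in Ω, ∑ i, fderiv ℝ (fun y => ψ y * F y i) x (EuclideanSpace.single i 1) =
      ∫ x, ∑ i, fderiv ℝ (fun y => ψ y * F y i) x (EuclideanSpace.single i 1) := by
    refine setIntegral_eq_integral_of_forall_compl_eq_zero fun x hx =>
      Finset.sum_eq_zero fun i _ => ?_
    have h0 : ψ =ᶠ[𝓝 x] 0 := notMem_tsupport_iff_eventuallyEq.1 fun h => hx (hs h)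
    have : (fun x => ψ x * F x i) =ᶠ[𝓝 x] fun _ => 0 := by
      filter_upwards [h0] with y hy
      simp [hy]
    simp [this.fderiv_eq]
  rw [← hout] at hzero
  rw [← hzero]
  refine setIntegral_congr_fun hΩ.measurableSet fun x hx => ?_
  exact (divergence_mul_eq (hψ.differentiable one_ne_zero x)
    ((hF.contDiffAt (hΩ.mem_nhds hx)).differentiableAt one_ne_zero)).symm

/-! ### Boundary charts and thin boundary layers -/

/-- A layer of width `ε` below a graph has volume `O(ε)`: its translates are disjoint. -/
theorem exists_volume_layer_le {n : ℕ} {x : EuclideanSpace ℝ (Fin n)} {r : ℝ}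
    {e : EuclideanSpace ℝ (Fin n)} (he : ‖e‖ = 1) {d : EuclideanSpace ℝ (Fin n) → ℝ}
    (hd : Continuous d) (hde : ∀ y t, d (y + t • e) = d y - t) :
    ∃ C : ℝ, 0 ≤ C ∧ ∀ ε : ℝ, 0 < ε → ε ≤ 1 →
      volume.real (Metric.ball x r ∩ {y | 0 < d y ∧ d y < ε}) ≤ C * ε := by
  have hfin (R : ℝ) : volume (Metric.ball x R) ≠ ⊤ := measure_ball_lt_top.ne
  -- About `1 / ε` disjoint copies of the layer, shifted along `e` by at most `1`, fit in the ball
  -- of radius `r + 1`. The factor `2` pays for rounding `1 / ε` down, which is where `ε ≤ 1`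
  -- enters.
  refine ⟨2 * volume.real (Metric.ball x (r + 1)), by positivity, fun ε hε hε1 => ?_⟩
  set S : Set (EuclideanSpace ℝ (Fin n)) := Metric.ball x r ∩ {y | 0 < d y ∧ d y < ε} with hS
  have hSm : MeasurableSet S := (Metric.isOpen_ball.inter
    ((isOpen_lt continuous_const hd).inter (isOpen_lt hd continuous_const))).measurableSet
  set N : ℕ := ⌊ε⁻¹⌋₊ with hN
  have hN1 : (N : ℝ) * ε ≤ 1 := by
    have := Nat.floor_le (inv_nonneg.2 hε.le)
    calc (N : ℝ) * ε ≤ ε⁻¹ * ε := by gcongr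
      _ = 1 := inv_mul_cancel₀ hε.ne'
  have hN2 : 1 ≤ 2 * (N : ℝ) * ε := by
    have h1 : ε⁻¹ < N + 1 := Nat.lt_floor_add_one _
    have h2 : (1 : ℝ) ≤ N := by
      exact_mod_cast Nat.le_floor (by simpa using (one_le_inv₀ hε).2 hε1)
    have h3 : ε⁻¹ ≤ 2 * N := by linarith
    calc 1 = ε⁻¹ * ε := (inv_mul_cancel₀ hε.ne').symm
      _ ≤ _ := by gcongr
  let T : ℕ → Set (EuclideanSpace ℝ (Fin n)) := fun j => (fun y => y + ((j : ℝ) * ε) • e) ⁻¹' S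
  have hTm (j : ℕ) : MeasurableSet (T j) := (measurable_add_const _) hSm
  have hTvol (j : ℕ) : volume (T j) = volume S := measure_preimage_add_right _ _ _
  -- On `T j` the value of `d` lies strictly between `j * ε` and `(j + 1) * ε`.
  have hTdisj : Pairwise (Function.onFun Disjoint T) := by
    intro i j hij
    refine Set.disjoint_left.2 fun y hi hj => hij ?_
    have hi' := hi.2
    have hj' := hj.2
    simp only [mem_ofPred_eq, hde] at hi' hj'
    have h1 : (i : ℝ) * ε < (j + 1) * ε := by linarith
    have h2 : (j : ℝ) * ε < (i + 1) * ε := by linarith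
    have h1' : (i : ℝ) < j + 1 := lt_of_mul_lt_mul_right h1 hε.le
    have h2' : (j : ℝ) < i + 1 := lt_of_mul_lt_mul_right h2 hε.le
    have h1'' : i < j + 1 := by exact_mod_cast h1'
    have h2'' : j < i + 1 := by exact_mod_cast h2'
    omega
  have hTsub : ⋃ j ∈ Finset.range N, T j ⊆ Metric.ball x (r + 1) := by
    intro y hy
    simp only [mem_iUnion] at hy
    obtain ⟨j, hj, hy⟩ := hy
    have hy1 : dist (y + ((j : ℝ) * ε) • e) x < r := hy.1
    have hjN : (j : ℝ) ≤ N := by exact_mod_cast (Finset.mem_range.1 hj).le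
    have hy2 : dist y (y + ((j : ℝ) * ε) • e) ≤ 1 := by
      rw [dist_self_add_right, norm_smul, he, mul_one, Real.norm_of_nonneg (by positivity)]
      exact le_trans (by gcongr) hN1
    exact lt_of_le_of_lt (dist_triangle _ _ _) (by linarith)
  have hsum : (N : ℝ) * volume.real S ≤ volume.real (Metric.ball x (r + 1)) := by
    have h1 : volume (⋃ j ∈ Finset.range N, T j) = N * volume S := by
      rw [measure_biUnion_finset (fun i _ j _ hij => hTdisj hij) fun j _ => hTm j]
      simp [hTvol]
    have h2 : (N : ENNReal) * volume S ≤ volume (Metric.ball x (r + 1)) :=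
      h1 ▸ measure_mono hTsub
    have h3 := ENNReal.toReal_mono (hfin (r + 1)) h2
    simpa [Measure.real] using h3
  have hS0 : 0 ≤ volume.real S := measureReal_nonneg
  calc volume.real S = 1 * volume.real S := (one_mul _).symm
    _ ≤ (2 * N * ε) * volume.real S := by gcongr
    _ = 2 * (N * volume.real S) * ε := by ring
    _ ≤ 2 * volume.real (Metric.ball x (r + 1)) * ε := by gcongr

theorem inner_gradient_eq_fderiv {n : ℕ} (f : EuclideanSpace ℝ (Fin n) → ℝ)
    (x w : EuclideanSpace ℝ (Fin n)) : inner ℝ (gradient f x) w = fderiv ℝ f x w := by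
  rw [← toDual_gradient, InnerProductSpace.toDual_apply_apply]

/-- The defining function `γ - ⟪e, ·⟫` of a chart, which is positive in `Ω`. -/
def heightBelow {n : ℕ} (e : EuclideanSpace ℝ (Fin n)) (γ : EuclideanSpace ℝ (Fin n) → ℝ)
    (y : EuclideanSpace ℝ (Fin n)) : ℝ :=
  γ y - inner ℝ e y

namespace IsBoundaryChart

variable {n : ℕ} {Ω : Set (EuclideanSpace ℝ (Fin n))} {x e : EuclideanSpace ℝ (Fin n)} {r : ℝ}
  {γ : EuclideanSpace ℝ (Fin n) → ℝ}

theorem contDiff_heightBelow (h : IsBoundaryChart Ω x r e γ) : ContDiff ℝ ∞ (heightBelow e γ) :=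
  h.smooth.sub (contDiff_const.inner ℝ contDiff_id)

theorem heightBelow_add_smul (h : IsBoundaryChart Ω x r e γ) (y : EuclideanSpace ℝ (Fin n))
    (t : ℝ) : heightBelow e γ (y + t • e) = heightBelow e γ y - t := by
  simp only [heightBelow, h.invariant, inner_add_right, inner_smul_right,
    real_inner_self_eq_norm_sq, h.norm_dir]
  ring

theorem mem_iff_heightBelow_pos (h : IsBoundaryChart Ω x r e γ) {y : EuclideanSpace ℝ (Fin n)}
    (hy : y ∈ Metric.ball x r) : y ∈ Ω ↔ 0 < heightBelow e γ y := by
  rw [h.mem_iff y hy, heightBelow, sub_pos]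

theorem fderiv_heightBelow (h : IsBoundaryChart Ω x r e γ) (y w : EuclideanSpace ℝ (Fin n)) :
    fderiv ℝ (heightBelow e γ) y w = -inner ℝ w (e - gradient γ y) := by
  have h1 : HasFDerivAt γ (fderiv ℝ γ y) y :=
    (h.smooth.differentiable (by simp) y).hasFDerivAt
  have h2 : HasFDerivAt (fun y => inner ℝ e y) (innerSL ℝ e) y := (innerSL ℝ e).hasFDerivAt
  have h3 : HasFDerivAt (heightBelow e γ) (fderiv ℝ γ y - innerSL ℝ e) y := h1.sub h2
  rw [h3.fderiv, inner_sub_right, real_inner_comm (gradient γ y) w, inner_gradient_eq_fderiv,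
    real_inner_comm e w]
  simp

/-- A chart at `x` is also a chart at the boundary points near `x`. -/
theorem of_mem_ball (h : IsBoundaryChart Ω x r e γ) {y : EuclideanSpace ℝ (Fin n)}
    (hy : y ∈ Metric.ball x r) : IsBoundaryChart Ω y (r - dist y x) e γ where
  radius_pos := sub_pos.2 hy
  norm_dir := h.norm_dir
  smooth := h.smooth
  invariant := h.invariant
  mem_iff z hz := h.mem_iff z (Metric.ball_subset_ball' (by linarith) hz)

end IsBoundaryChart

/-! ### The divergence theorem for tangential fields -/

theorem integrableOn_test_divergence {n : ℕ} {Ω : Set (EuclideanSpace ℝ (Fin n))}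
    (hΩ : IsOpen Ω) (hb : Bornology.IsBounded Ω)
    {F : EuclideanSpace ℝ (Fin n) → EuclideanSpace ℝ (Fin n)} (hF : ContinuousOn F (closure Ω))
    (hdiv : IntegrableOn (divergence F) Ω) {ψ : EuclideanSpace ℝ (Fin n) → ℝ}
    (hψ : ContDiff ℝ 1 ψ) :
    IntegrableOn (fun x => fderiv ℝ ψ x (F x) + ψ x * divergence F x) Ω := by
  have hK : IsCompact (closure Ω) := hb.isCompact_closure
  have h1 : IntegrableOn (fun x => fderiv ℝ ψ x (F x)) (closure Ω) :=
    (((hψ.continuous_fderiv one_ne_zero).continuousOn).clm_apply hF).integrableOn_compact hK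
  obtain ⟨C, hC⟩ := hK.exists_bound_of_continuousOn hψ.continuous.continuousOn
  refine (h1.mono_set subset_closure).add ?_
  refine hdiv.bdd_mul (c := C) hψ.continuous.aestronglyMeasurable ?_
  exact (ae_restrict_iff' hΩ.measurableSet).2 (.of_forall fun y hy => hC y (subset_closure hy))

/-- Composed with `d / ε`, where `d` is the height below the graph, this profile removes a layer at
the boundary. Its derivative lives where `ε ≤ d ≤ 2 * ε`. -/
theorem exists_cutoff_profile : ∃ h : ℝ → ℝ, ContDiff ℝ ∞ h ∧ (∀ t, ‖h t‖ ≤ 1) ∧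
    (∀ t ≤ 1, h t = 0) ∧ (∀ t, 2 ≤ t → h t = 1) ∧ (∀ t, t ∉ Icc (1 : ℝ) 2 → deriv h t = 0) ∧
    ∃ H : ℝ, 0 ≤ H ∧ ∀ t, ‖deriv h t‖ ≤ H := by
  set h : ℝ → ℝ := fun t => Real.smoothTransition (t - 1) with hh
  have hsm : ContDiff ℝ ∞ h :=
    (Real.smoothTransition.contDiff (n := ⊤)).comp (contDiff_id.sub contDiff_const)
  have h0 : ∀ t ≤ 1, h t = 0 := fun t ht =>
    Real.smoothTransition.zero_of_nonpos (by linarith)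
  have h1 : ∀ t, 2 ≤ t → h t = 1 := fun t ht =>
    Real.smoothTransition.one_of_one_le (by linarith)
  have hd : ∀ t, t ∉ Icc (1 : ℝ) 2 → deriv h t = 0 := by
    intro t ht
    rcases lt_or_ge t 1 with ht1 | ht1
    · have : h =ᶠ[𝓝 t] fun _ => 0 := by
        filter_upwards [Iio_mem_nhds ht1] with s hs using h0 s (le_of_lt hs)
      simp [this.deriv_eq]
    · have ht2 : 2 < t := not_le.1 fun h => ht ⟨ht1, h⟩
      have : h =ᶠ[𝓝 t] fun _ => 1 := by
        filter_upwards [Ioi_mem_nhds ht2] with s hs using h1 s (le_of_lt hs)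
      simp [this.deriv_eq]
  obtain ⟨H, hH⟩ := (isCompact_Icc (a := (1 : ℝ)) (b := 2)).exists_bound_of_continuousOn
    (hsm.continuous_deriv (by simp)).continuousOn
  refine ⟨h, hsm, fun t => ?_, h0, h1, hd, max H 0, le_max_right _ _, fun t => ?_⟩
  · rw [Real.norm_of_nonneg (Real.smoothTransition.nonneg _)]
    exact Real.smoothTransition.le_one _
  · by_cases ht : t ∈ Icc (1 : ℝ) 2
    · exact (hH t ht).trans (le_max_left _ _)
    · simp [hd t ht]

/-- Integration by parts near a boundary point, for a vector field that is tangent to the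
boundary there. -/
theorem integral_divergence_of_tsupport_subset_ball {n : ℕ}
    {Ω : Set (EuclideanSpace ℝ (Fin n))} (hΩ : IsOpen Ω) (hb : Bornology.IsBounded Ω)
    {F : EuclideanSpace ℝ (Fin n) → EuclideanSpace ℝ (Fin n)} (hF : ContDiffOn ℝ 1 F Ω)
    (hFc : ContinuousOn F (closure Ω)) (hdiv : IntegrableOn (divergence F) Ω)
    {x e : EuclideanSpace ℝ (Fin n)} {r : ℝ} {γ : EuclideanSpace ℝ (Fin n) → ℝ}
    (hchart : IsBoundaryChart Ω x r e γ)
    (hflux : ∀ y ∈ frontier Ω, y ∈ Metric.ball x r → inner ℝ (F y) (e - gradient γ y) = 0)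
    {ψ : EuclideanSpace ℝ (Fin n) → ℝ} (hψ : ContDiff ℝ 1 ψ) (hc : HasCompactSupport ψ)
    (hs : tsupport ψ ⊆ Metric.ball x r) :
    ∫ y in Ω, (fderiv ℝ ψ y (F y) + ψ y * divergence F y) = 0 := by
  obtain ⟨h, hsm, hle, h0, h1, hd0, H, hH0, hH⟩ := exists_cutoff_profile
  have hK : IsCompact (closure Ω) := hb.isCompact_closure
  set d := heightBelow e γ with hd
  have hds : ContDiff ℝ 1 d := hchart.contDiff_heightBelow.of_le (by simp)
  set I : EuclideanSpace ℝ (Fin n) → ℝ := fun y => fderiv ℝ ψ y (F y) + ψ y * divergence F y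
    with hI
  have hIint : IntegrableOn I Ω := integrableOn_test_divergence hΩ hb hFc hdiv hψ
  set q : EuclideanSpace ℝ (Fin n) → ℝ := fun y => fderiv ℝ d y (F y) with hq
  have hqc : ContinuousOn q (closure Ω) :=
    ((hds.continuous_fderiv one_ne_zero).continuousOn).clm_apply hFc
  -- `J ε` is the error made by differentiating the cutoff `h (d / ε)`. It contains the factor `1 /
  -- ε`, compensated by the `O(ε)` volume of the layer; it tends to zero because the normal
  -- component `q` of `F` does so at the boundary.
  set J : ℝ → EuclideanSpace ℝ (Fin n) → ℝ := fun ε y => ψ y * (deriv h (d y / ε) / ε * q y)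
    with hJ
  have hψ0 : ∀ y, y ∉ tsupport ψ → ψ y = 0 := fun y hy => image_eq_zero_of_notMem_tsupport hy
  have hI0 : ∀ y, y ∉ tsupport ψ → I y = 0 := by
    intro y hy
    have h2 : fderiv ℝ ψ y = 0 := by
      simpa using (notMem_tsupport_iff_eventuallyEq.1 hy).fderiv_eq
    simp [hI, h2, hψ0 y hy]
  obtain ⟨C, hC0, hC⟩ := exists_volume_layer_le (x := x) (r := r) hchart.norm_dir
    hds.continuous hchart.heightBelow_add_smul
  obtain ⟨P, hP⟩ := hc.exists_bound_of_continuous hψ.continuous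
  have hP0 : 0 ≤ P := (norm_nonneg _).trans (hP x)
  have hident : ∀ ε, 0 < ε → ∫ y in Ω, h (d y / ε) * I y = - ∫ y in Ω, J ε y := by
    intro ε hε
    have hhd : ContDiff ℝ 1 fun y => h (d y / ε) :=
      (hsm.of_le (by simp)).comp (hds.div_const ε)
    -- The profile vanishes up to `1`, so the support stays in the closed set `ε ≤ d`, away from the
    -- boundary.
    have hsupp : tsupport (fun y => ψ y * h (d y / ε)) ⊆ Ω := by
      have h3 : tsupport (fun y => ψ y * h (d y / ε)) ⊆ tsupport ψ ∩ {y | ε ≤ d y} := by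
        refine closure_minimal (fun y hy => ?_)
          ((isClosed_tsupport ψ).inter (isClosed_le continuous_const hds.continuous))
        rw [Function.mem_support] at hy
        refine ⟨subset_tsupport _ (left_ne_zero_of_mul hy), ?_⟩
        by_contra hlt
        refine right_ne_zero_of_mul hy (h0 _ ?_)
        rw [div_le_one hε]
        exact (not_le.1 hlt).le
      intro y hy
      exact (hchart.mem_iff_heightBelow_pos (hs (h3 hy).1)).2 (hε.trans_le (h3 hy).2)
    have hA := integral_divergence_of_tsupport_subset hΩ hF (hψ.mul hhd) hc.mul_right hsupp
    have hpt : ∀ y, fderiv ℝ (fun y => ψ y * h (d y / ε)) y (F y) +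
        ψ y * h (d y / ε) * divergence F y = h (d y / ε) * I y + J ε y := by
      intro y
      have e1 : HasFDerivAt ψ (fderiv ℝ ψ y) y := (hψ.differentiable one_ne_zero y).hasFDerivAt
      have e2 : HasFDerivAt (fun y => h (d y / ε))
          (deriv h (d y / ε) • (ε⁻¹ • fderiv ℝ d y)) y := by
        have e3 : HasFDerivAt (fun y => d y / ε) (ε⁻¹ • fderiv ℝ d y) y := by
          simpa [div_eq_inv_mul] using
            (hds.differentiable one_ne_zero y).hasFDerivAt.const_mul ε⁻¹
        exact ((hsm.differentiable (by simp) (d y / ε)).hasDerivAt).comp_hasFDerivAt y e3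
      rw [(e1.fun_mul e2).fderiv]
      simp only [hI, hJ, hq, _root_.add_apply, _root_.smul_apply,
        smul_eq_mul]
      ring
    have hi1 : IntegrableOn (fun y => h (d y / ε) * I y) Ω :=
      hIint.bdd_mul (c := 1) hhd.continuous.aestronglyMeasurable (.of_forall fun y => hle _)
    have hi2 : IntegrableOn (J ε) Ω := by
      have : ContinuousOn (J ε) (closure Ω) := by
        refine hψ.continuous.continuousOn.mul (ContinuousOn.mul ?_ hqc)
        exact (((hsm.continuous_deriv (by simp)).comp
          (hds.continuous.div_const ε)).div_const ε).continuousOn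
      exact (this.integrableOn_compact hK).mono_set subset_closure
    have hA' : ∫ y in Ω, (h (d y / ε) * I y + J ε y) = 0 := by
      rw [← hA]
      exact integral_congr_ae (.of_forall fun y => (hpt y).symm)
    rw [integral_add hi1 hi2] at hA'
    linarith
  -- Tangency gives `q = 0` at boundary points in the support of `ψ`. Hence `d` is positive on the
  -- compact set where `‖q‖ ≥ δ`, and therefore bounded below there.
  have hsmall : ∀ δ > 0, ∃ η > 0, ∀ y ∈ Ω, y ∈ tsupport ψ → d y < η → ‖q y‖ ≤ δ := by
    intro δ hδ
    have hcomp : IsCompact ((closure Ω ∩ tsupport ψ) ∩ {y | δ ≤ ‖q y‖}) := by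
      have hcl : IsClosed ((closure Ω ∩ tsupport ψ) ∩ (fun y => ‖q y‖) ⁻¹' Ici δ) :=
        (hqc.norm.mono inter_subset_left).preimage_isClosed_of_isClosed
          (isClosed_closure.inter (isClosed_tsupport ψ)) isClosed_Ici
      exact hK.of_isClosed_subset hcl fun y hy => hy.1.1
    obtain ⟨η, hη, hη'⟩ := hcomp.exists_forall_le' (f := d) hds.continuous.continuousOn (a := 0) (by
      rintro y ⟨⟨hy1, hy2⟩, hy3⟩
      by_contra hneg
      have hyΩ : y ∉ Ω := fun hy => hneg ((hchart.mem_iff_heightBelow_pos (hs hy2)).1 hy)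
      have hfr : y ∈ frontier Ω := by
        rw [hΩ.frontier_eq]
        exact ⟨hy1, hyΩ⟩
      have : q y = 0 := by
        rw [hq, hd]
        simp only
        rw [hchart.fderiv_heightBelow, hflux y hfr (hs hy2), neg_zero]
      rw [mem_ofPred_eq, this, norm_zero] at hy3
      linarith)
    refine ⟨η, hη, fun y hy hys hdy => ?_⟩
    by_contra hcon
    exact absurd (hη' y ⟨⟨subset_closure hy, hys⟩, (not_le.1 hcon).le⟩) (not_le.2 hdy)
  have hJbound : ∀ δ > 0, ∃ η > 0, ∀ ε, 0 < ε → ε < η →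
      ‖∫ y in Ω, J ε y‖ ≤ 3 * C * P * H * δ := by
    intro δ hδ
    obtain ⟨η, hη, hη'⟩ := hsmall δ hδ
    -- The layer has width `3 * ε`, so that its strict upper bound includes the closed range `d ≤ 2
    -- * ε` where the derivative of the cutoff may be non-zero.
    refine ⟨min (η / 3) (1 / 3), by positivity, fun ε hε hεη => ?_⟩
    have hε1 : 3 * ε < η := by linarith [hεη.trans_le (min_le_left _ _)]
    have hε2 : 3 * ε ≤ 1 := by linarith [hεη.trans_le (min_le_right _ _)]
    set S : Set (EuclideanSpace ℝ (Fin n)) :=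
      Metric.ball x r ∩ {y | 0 < d y ∧ d y < 3 * ε} with hS
    have hz : ∀ y ∈ Ω \ (Ω ∩ S), J ε y = 0 := by
      rintro y ⟨hy, hyS⟩
      by_cases hys : y ∈ tsupport ψ
      · have hpos : 0 < d y := (hchart.mem_iff_heightBelow_pos (hs hys)).1 hy
        have hge : 3 * ε ≤ d y := by
          by_contra hlt
          exact hyS ⟨hy, hs hys, hpos, not_le.1 hlt⟩
        have : deriv h (d y / ε) = 0 := by
          refine hd0 _ fun hmem => ?_
          have := (div_le_iff₀ hε).1 hmem.2
          linarith
        simp [hJ, this]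
      · simp [hJ, hψ0 y hys]
    rw [setIntegral_eq_of_subset_of_forall_sdiff_eq_zero hΩ.measurableSet inter_subset_left hz]
    have hfinS : volume S < ⊤ := (measure_mono inter_subset_left).trans_lt measure_ball_lt_top
    have hfin : volume (Ω ∩ S) < ⊤ := (measure_mono inter_subset_right).trans_lt hfinS
    have hb1 : ∀ y ∈ Ω ∩ S, ‖J ε y‖ ≤ P * (H / ε * δ) := by
      rintro y ⟨hy, hyS⟩
      by_cases hys : y ∈ tsupport ψ
      · simp only [hJ, norm_mul, norm_div, Real.norm_of_nonneg hε.le]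
        gcongr
        · exact hP y
        · exact hH _
        · exact hη' y hy hys (hyS.2.2.trans hε1)
      · simp only [hJ, hψ0 y hys, zero_mul, norm_zero]
        positivity
    calc ‖∫ y in Ω ∩ S, J ε y‖ ≤ P * (H / ε * δ) * volume.real (Ω ∩ S) :=
          norm_setIntegral_le_of_norm_le_const hfin hb1
      _ ≤ P * (H / ε * δ) * (C * (3 * ε)) := by
          gcongr
          exact (measureReal_mono inter_subset_right hfinS.ne).trans
            (hC (3 * ε) (by positivity) hε2)
      _ = 3 * C * P * H * δ := by
          field_simp
  have hJlim : Tendsto (fun ε => ∫ y in Ω, J ε y) (𝓝[>] 0) (𝓝 0) := by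
    rw [Metric.tendsto_nhdsWithin_nhds]
    intro ρ hρ
    -- The `+ 1` keeps the denominator positive, since the constant may vanish.
    obtain ⟨η, hη, hη'⟩ := hJbound (ρ / (3 * C * P * H + 1)) (by positivity)
    refine ⟨η, hη, fun {ε} hε hεη => ?_⟩
    rw [dist_zero_right, Real.norm_of_nonneg (le_of_lt hε)] at hεη
    rw [dist_zero_right]
    refine (hη' ε hε hεη).trans_lt ?_
    rw [mul_div_assoc', div_lt_iff₀ (by positivity)]
    nlinarith
  have hIlim : Tendsto (fun ε => ∫ y in Ω, h (d y / ε) * I y) (𝓝[>] 0) (𝓝 (∫ y in Ω, I y)) := by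
    refine tendsto_integral_filter_of_dominated_convergence (fun y => ‖I y‖) ?_ ?_ hIint.norm ?_
    · refine .of_forall fun ε => AEStronglyMeasurable.mul ?_ hIint.aestronglyMeasurable
      exact (hsm.continuous.comp (hds.continuous.div_const ε)).aestronglyMeasurable
    · refine .of_forall fun ε => .of_forall fun y => ?_
      rw [norm_mul]
      exact mul_le_of_le_one_left (norm_nonneg _) (hle _)
    · refine (ae_restrict_iff' hΩ.measurableSet).2 (.of_forall fun y hy => ?_)
      by_cases hys : y ∈ tsupport ψ
      · have hpos : 0 < d y := (hchart.mem_iff_heightBelow_pos (hs hys)).1 hy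
        refine tendsto_const_nhds.congr' ?_
        filter_upwards [self_mem_nhdsWithin,
          mem_nhdsWithin_of_mem_nhds (Iio_mem_nhds (half_pos hpos))] with ε hε hε'
        rw [h1, one_mul]
        rw [le_div_iff₀ hε]
        linarith [mem_Iio.1 hε']
      · simp [hI0 y hys]
  have hIlim' : Tendsto (fun ε => ∫ y in Ω, h (d y / ε) * I y) (𝓝[>] 0) (𝓝 0) := by
    have := hJlim.neg
    rw [neg_zero] at this
    refine this.congr' ?_
    filter_upwards [self_mem_nhdsWithin] with ε hε using (hident ε hε).symm
  exact tendsto_nhds_unique hIlim hIlim'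

/-- The divergence theorem for a vector field that is tangent to the boundary. -/
theorem integral_divergence_eq_zero {n : ℕ} {Ω : Set (EuclideanSpace ℝ (Fin n))}
    (hΩ : IsSmoothBoundedDomain Ω)
    {F : EuclideanSpace ℝ (Fin n) → EuclideanSpace ℝ (Fin n)} (hF : ContDiffOn ℝ 1 F Ω)
    (hFc : ContinuousOn F (closure Ω)) (hdiv : IntegrableOn (divergence F) Ω)
    (hflux : ∀ y ∈ frontier Ω, ∀ ν, IsOutwardUnitNormal Ω y ν → inner ℝ (F y) ν = 0) :
    ∫ y in Ω, divergence F y = 0 := by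
  have hK : IsCompact (closure Ω) := hΩ.isBounded.isCompact_closure
  have hlocal : ∀ p ∈ closure Ω, ∃ U : Set (EuclideanSpace ℝ (Fin n)), IsOpen U ∧ p ∈ U ∧
      ∀ ψ : EuclideanSpace ℝ (Fin n) → ℝ, ContDiff ℝ 1 ψ → tsupport ψ ⊆ U →
        ∫ y in Ω, (fderiv ℝ ψ y (F y) + ψ y * divergence F y) = 0 := by
    intro p hp
    by_cases hpΩ : p ∈ Ω
    · refine ⟨Ω, hΩ.isOpen, hpΩ, fun ψ hψ hs => ?_⟩
      exact integral_divergence_of_tsupport_subset hΩ.isOpen hF hψ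
        (Metric.isCompact_of_isClosed_isBounded (isClosed_tsupport ψ) (hΩ.isBounded.subset hs)) hs
    · have hpf : p ∈ frontier Ω := by
        rw [hΩ.isOpen.frontier_eq]
        exact ⟨hp, hpΩ⟩
      obtain ⟨r, e, γ, hchart⟩ := hΩ.smooth_boundary p hpf
      refine ⟨Metric.ball p r, Metric.isOpen_ball, Metric.mem_ball_self hchart.radius_pos,
        fun ψ hψ hs => ?_⟩
      refine integral_divergence_of_tsupport_subset_ball hΩ.isOpen hΩ.isBounded hF hFc hdiv hchart
        (fun y hy hyb => ?_) hψ (Metric.isCompact_of_isClosed_isBounded (isClosed_tsupport ψ)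
          (Metric.isBounded_ball.subset hs)) hs
      have h1 := hflux y hy _ ⟨hy, _, e, γ, hchart.of_mem_ball hyb, rfl⟩
      -- The flux condition is stated for the normalised vector; a non-zero normalising factor can
      -- be cancelled, and for the zero vector the claim is trivial.
      by_cases h0 : e - gradient γ y = 0
      · simp [h0]
      · rw [inner_smul_right] at h1
        exact (mul_eq_zero.1 h1).resolve_left (inv_ne_zero (norm_ne_zero_iff.2 h0))
  choose! U hUo hUmem hU using hlocal
  obtain ⟨t, ht⟩ := hK.elim_nhds_subcover' (fun p _ => U p)
    fun p hp => (hUo p hp).mem_nhds (hUmem p hp)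
  obtain ⟨ρ, hρ⟩ := SmoothPartitionOfUnity.exists_isSubordinate
    (modelWithCornersSelf ℝ (EuclideanSpace ℝ (Fin n))) (s := closure Ω) isClosed_closure
    (fun p : t => U p.1) (fun p => hUo _ p.1.2) (fun y hy => by
      obtain ⟨p, hp, hy⟩ := mem_iUnion₂.1 (ht hy)
      exact mem_iUnion.2 ⟨⟨p, hp⟩, hy⟩)
  have hρs (i : t) : ContDiff ℝ 1 (ρ i) := ((ρ i).contMDiff.contDiff).of_le (by simp)
  have hone : ∀ y ∈ Ω, ∑ i, ρ i y = 1 := by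
    intro y hy
    rw [← finsum_eq_sum_of_fintype]
    exact ρ.sum_eq_one (subset_closure hy)
  have hsum : ∫ y in Ω, ∑ i, (fderiv ℝ (ρ i) y (F y) + ρ i y * divergence F y) = 0 := by
    rw [integral_finsetSum _ fun i _ =>
      integrableOn_test_divergence hΩ.isOpen hΩ.isBounded hFc hdiv (hρs i)]
    exact Finset.sum_eq_zero fun i _ => hU i.1 i.1.2 _ (hρs i) (hρ i)
  rw [← hsum]
  refine setIntegral_congr_fun hΩ.isOpen.measurableSet fun y hy => ?_
  -- The functions of the partition sum to `1` on the open set `Ω`, so their derivatives cancel and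
  -- only the divergence is left.
  have hder : ∑ i, fderiv ℝ (ρ i) y = 0 := by
    rw [← fderiv_fun_sum fun i _ => (hρs i).differentiable one_ne_zero y]
    have : (fun y => ∑ i, ρ i y) =ᶠ[𝓝 y] fun _ => 1 := by
      filter_upwards [hΩ.isOpen.mem_nhds hy] with z hz using hone z hz
    exact this.fderiv_eq.trans (by simp)
  simp only [Finset.sum_add_distrib]
  rw [← Finset.sum_mul, hone y hy, one_mul, ← _root_.sum_apply, hder]
  simp

/-! ### The weak form of the mixed problem -/

theorem divergence_eq_sum_fderiv {n : ℕ}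
    {F : EuclideanSpace ℝ (Fin n) → EuclideanSpace ℝ (Fin n)} {x : EuclideanSpace ℝ (Fin n)}
    (hF : DifferentiableAt ℝ F x) :
    divergence F x = ∑ i, fderiv ℝ (fun y => F y i) x (EuclideanSpace.single i 1) := by
  refine Finset.sum_congr rfl fun i _ => ?_
  have hcoord : HasFDerivAt (fun y => F y i)
      ((EuclideanSpace.proj i : EuclideanSpace ℝ (Fin n) →L[ℝ] ℝ).comp (fderiv ℝ F x)) x :=
    (EuclideanSpace.proj i : EuclideanSpace ℝ (Fin n) →L[ℝ] ℝ).hasFDerivAt.comp x hF.hasFDerivAt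
  rw [hcoord.fderiv]
  rfl

theorem gradient_apply {n : ℕ} (f : EuclideanSpace ℝ (Fin n) → ℝ)
    (x : EuclideanSpace ℝ (Fin n)) (i : Fin n) :
    gradient f x i = fderiv ℝ f x (EuclideanSpace.single i 1) := by
  rw [← inner_gradient_eq_fderiv, EuclideanSpace.inner_single_right]
  simp

theorem contDiffOn_gradient {n : ℕ} {Ω : Set (EuclideanSpace ℝ (Fin n))} (hΩ : IsOpen Ω)
    {v : EuclideanSpace ℝ (Fin n) → ℝ} {m k : WithTop ℕ∞} (hv : ContDiffOn ℝ k v Ω)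
    (hmk : m + 1 ≤ k) : ContDiffOn ℝ m (gradient v) Ω :=
  (InnerProductSpace.toDual ℝ (EuclideanSpace ℝ (Fin n))).symm.contDiff.comp_contDiffOn
    (hv.fderiv_of_isOpen hΩ hmk)

theorem divergence_gradient {n : ℕ} {Ω : Set (EuclideanSpace ℝ (Fin n))} (hΩ : IsOpen Ω)
    {v : EuclideanSpace ℝ (Fin n) → ℝ} (hv : ContDiffOn ℝ 2 v Ω) {x : EuclideanSpace ℝ (Fin n)}
    (hx : x ∈ Ω) : divergence (gradient v) x = Laplacian.laplacian v x := by
  have hd : DifferentiableAt ℝ (gradient v) x :=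
    ((contDiffOn_gradient hΩ hv (m := 1) (by norm_num)).contDiffAt
      (hΩ.mem_nhds hx)).differentiableAt one_ne_zero
  have hd' : DifferentiableAt ℝ (fderiv ℝ v) x :=
    ((hv.fderiv_of_isOpen hΩ (m := 1) (by norm_num)).contDiffAt
      (hΩ.mem_nhds hx)).differentiableAt one_ne_zero
  rw [divergence_eq_sum_fderiv hd, InnerProductSpace.laplacian_eq_iteratedFDeriv_orthonormalBasis v
    (EuclideanSpace.basisFun (Fin n) ℝ)]
  refine Finset.sum_congr rfl fun i _ => ?_
  rw [iteratedFDeriv_two_apply]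
  simp only [gradient_apply]
  rw [(hd'.hasFDerivAt.clm_apply (hasFDerivAt_const (EuclideanSpace.single i 1) x)).fderiv]
  simp

theorem divergence_congr {n : ℕ} {F F' : EuclideanSpace ℝ (Fin n) → EuclideanSpace ℝ (Fin n)}
    {x : EuclideanSpace ℝ (Fin n)} (h : F =ᶠ[𝓝 x] F') : divergence F x = divergence F' x := by
  simp only [divergence, h.fderiv_eq]

/-- The weak form of the mixed boundary value problem. -/
theorem IsClassicalMixedSolution.integral_inner_gradient {n : ℕ}
    {Ω ΓD ΓN : Set (EuclideanSpace ℝ (Fin n))} (hΩ : IsSmoothBoundedDomain Ω)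
    (hΓ : IsBoundarySplitting Ω ΓD ΓN) {f v φ : EuclideanSpace ℝ (Fin n) → ℝ}
    (hv : IsClassicalMixedSolution Ω ΓD ΓN f v) (hf : IntegrableOn f Ω)
    (hφ : ContDiffOn ℝ 1 φ Ω) (hφc : ContinuousOn φ (closure Ω)) (hφD : ∀ x ∈ ΓD, φ x = 0)
    (hφg : IntegrableOn (gradient φ) Ω) :
    ∫ x in Ω, inner ℝ (gradient v x) (gradient φ x) = ∫ x in Ω, f x * φ x := by
  obtain ⟨hv2, hvc, hlap, hvD, G, hGc, hGv, hGN⟩ := hv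
  have hK : IsCompact (closure Ω) := hΩ.isBounded.isCompact_closure
  have ho := hΩ.isOpen
  have hGs : ContDiffOn ℝ 1 G Ω :=
    (contDiffOn_gradient ho hv2 (m := 1) (by norm_num)).congr hGv
  -- The field uses `G` instead of `gradient v`, because continuity up to the boundary is known only
  -- for `G`; the two agree in `Ω`.
  have hdiv : ∀ x ∈ Ω, divergence (fun y => φ y • G y) x =
      inner ℝ (gradient v x) (gradient φ x) - f x * φ x := by
    intro x hx
    have hφd := (hφ.contDiffAt (ho.mem_nhds hx)).differentiableAt one_ne_zero
    have hGd := (hGs.contDiffAt (ho.mem_nhds hx)).differentiableAt one_ne_zero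
    have hGe : G =ᶠ[𝓝 x] gradient v := by
      filter_upwards [ho.mem_nhds hx] with y hy using hGv y hy
    rw [divergence_eq_sum_fderiv (hφd.fun_smul hGd)]
    simp only [PiLp.smul_apply, smul_eq_mul]
    rw [divergence_mul_eq hφd hGd, divergence_congr hGe, divergence_gradient ho hv2 hx,
      ← inner_gradient_eq_fderiv, hGv x hx, real_inner_comm, ← hlap x hx]
    ring
  obtain ⟨A, hA⟩ := hK.exists_bound_of_continuousOn hGc
  obtain ⟨B, hB⟩ := hK.exists_bound_of_continuousOn hφc
  have hi1 : IntegrableOn (fun x => inner ℝ (gradient v x) (gradient φ x)) Ω := by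
    have hmeas : AEStronglyMeasurable (gradient v) (volume.restrict Ω) :=
      (contDiffOn_gradient ho hv2 (m := 1) (by norm_num)).continuousOn.aestronglyMeasurable
        ho.measurableSet
    refine (hφg.norm.const_mul A).mono' (hmeas.inner hφg.aestronglyMeasurable) ?_
    refine (ae_restrict_iff' ho.measurableSet).2 (.of_forall fun x hx => ?_)
    refine (norm_inner_le_norm _ _).trans ?_
    gcongr
    rw [← hGv x hx]
    exact hA x (subset_closure hx)
  have hi2 : IntegrableOn (fun x => f x * φ x) Ω := by
    refine hf.mul_bdd (c := B)
      ((hφc.mono subset_closure).aestronglyMeasurable ho.measurableSet) ?_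
    exact (ae_restrict_iff' ho.measurableSet).2 (.of_forall fun x hx => hB x (subset_closure hx))
  have hint : ∫ x in Ω, divergence (fun y => φ y • G y) x = 0 := by
    -- The flux of `φ • G` vanishes on `ΓD` through `φ` and on `ΓN` through the Neumann condition.
    refine integral_divergence_eq_zero hΩ (hφ.smul hGs) (hφc.smul hGc) ?_ ?_
    · exact (hi1.sub hi2).congr_fun (fun x hx => (hdiv x hx).symm) ho.measurableSet
    · intro y hy ν hν
      rw [hΓ.union_eq] at hy
      rcases hy with hy | hy
      · simp [hφD y hy]
      · rw [real_inner_smul_left, hGN y hy ν hν, mul_zero]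
  rw [setIntegral_congr_fun ho.measurableSet hdiv, integral_sub hi1 hi2] at hint
  linarith

/-! ### The Poincaré inequality -/

/-- Cauchy-Schwarz for the fundamental theorem of calculus, obtained by expanding the non-negative
variance of `f'` about its mean. Differentiability is asked only in the open interval, since a
segment may end on the boundary of `Ω`. -/
theorem sq_sub_le_integral_sq_deriv {f f' : ℝ → ℝ} {T A : ℝ} (hT : 0 < T)
    (hf : ContinuousOn f (Icc 0 T)) (hd : ∀ t ∈ Ioo 0 T, HasDerivAt f (f' t) t)
    (hf' : ContinuousOn f' (Ioo 0 T)) (hA : ∀ t ∈ Ioo 0 T, |f' t| ≤ A) :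
    IntegrableOn (fun t => f' t ^ 2) (Ioo 0 T) ∧
      (f T - f 0) ^ 2 ≤ T * ∫ t in Ioo 0 T, f' t ^ 2 := by
  have hfin : volume (Ioo 0 T) ≠ ⊤ := by simp
  have hi1 : IntegrableOn f' (Ioo 0 T) :=
    .of_bound hfin.lt_top (hf'.aestronglyMeasurable measurableSet_Ioo) A
      ((ae_restrict_iff' measurableSet_Ioo).2 (.of_forall hA))
  have hi2 : IntegrableOn (fun t => f' t ^ 2) (Ioo 0 T) := by
    refine .of_bound hfin.lt_top ((hf'.pow 2).aestronglyMeasurable measurableSet_Ioo) (A ^ 2)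
      ((ae_restrict_iff' measurableSet_Ioo).2 (.of_forall fun t ht => ?_))
    rw [Real.norm_of_nonneg (sq_nonneg _), ← sq_abs]
    have := hA t ht
    gcongr
  refine ⟨hi2, ?_⟩
  have hftc : ∫ t in Ioo 0 T, f' t = f T - f 0 := by
    rw [← integral_Ioc_eq_integral_Ioo, ← intervalIntegral.integral_of_le hT.le]
    refine intervalIntegral.integral_eq_sub_of_hasDerivAt_of_le hT.le hf hd ?_
    rw [intervalIntegrable_iff_integrableOn_Ioo_of_le hT.le]
    exact hi1
  set m : ℝ := (f T - f 0) / T with hm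
  have h0 : 0 ≤ ∫ t in Ioo 0 T, (f' t - m) ^ 2 := integral_nonneg fun t => sq_nonneg _
  have h1 : ∫ t in Ioo 0 T, (f' t - m) ^ 2 =
      (∫ t in Ioo 0 T, f' t ^ 2) - 2 * m * (f T - f 0) + T * m ^ 2 := by
    have : ∀ t, (f' t - m) ^ 2 = (f' t ^ 2 - 2 * m * f' t) + m ^ 2 := fun t => by ring
    simp only [this]
    have hi3 : IntegrableOn (fun t => f' t ^ 2 - 2 * m * f' t) (Ioo 0 T) :=
      hi2.sub (hi1.const_mul _)
    rw [integral_add hi3 (integrableOn_const hfin),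
      integral_sub hi2 (hi1.const_mul _), integral_const_mul, hftc]
    simp [hT.le]
  have hmT : m * T = f T - f 0 := div_mul_cancel₀ _ hT.ne'
  rw [h1, ← hmT] at h0
  rw [← hmT]
  nlinarith

/-- The functions to which the Poincaré inequality applies: those of class `C¹` in `Ω`, continuous
up to the boundary, with bounded gradient, that vanish on `ΓD`. -/
structure IsDirichletTest {n : ℕ} (Ω ΓD : Set (EuclideanSpace ℝ (Fin n)))
    (v : EuclideanSpace ℝ (Fin n) → ℝ) : Prop where
  contDiffOn : ContDiffOn ℝ 1 v Ω
  continuousOn : ContinuousOn v (closure Ω)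
  eq_zero : ∀ x ∈ ΓD, v x = 0
  bounded_gradient : ∃ A, ∀ x ∈ Ω, ‖gradient v x‖ ≤ A

/-- The density of the Dirichlet integral, extended by zero. -/
def energyDensity {n : ℕ} (Ω : Set (EuclideanSpace ℝ (Fin n)))
    (v : EuclideanSpace ℝ (Fin n) → ℝ) : EuclideanSpace ℝ (Fin n) → ℝ≥0∞ :=
  Ω.indicator fun x => ENNReal.ofReal (‖gradient v x‖ ^ 2)

namespace IsDirichletTest

variable {n : ℕ} {Ω ΓD : Set (EuclideanSpace ℝ (Fin n))} {v : EuclideanSpace ℝ (Fin n) → ℝ}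

theorem continuousOn_gradient (hv : IsDirichletTest Ω ΓD v) (hΩ : IsOpen Ω) :
    ContinuousOn (gradient v) Ω :=
  (contDiffOn_gradient hΩ hv.contDiffOn (m := 0) (by norm_num)).continuousOn

theorem measurable_energyDensity (hv : IsDirichletTest Ω ΓD v) (hΩ : IsOpen Ω) :
    Measurable (energyDensity Ω v) := by
  have h : ContinuousOn (fun x => ENNReal.ofReal (‖gradient v x‖ ^ 2)) Ω :=
    ENNReal.continuous_ofReal.comp_continuousOn ((hv.continuousOn_gradient hΩ).norm.pow 2)
  classical
  rw [energyDensity, ← piecewise_eq_indicator]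
  exact h.measurable_piecewise continuousOn_const hΩ.measurableSet

/-- The increment of `v` along a segment in `Ω` is controlled by the energy on the segment. -/
theorem ofReal_sq_sub_le (hv : IsDirichletTest Ω ΓD v) (hΩ : IsOpen Ω)
    {y w : EuclideanSpace ℝ (Fin n)} {T : ℝ} (hT : 0 < T)
    (hseg : ∀ t ∈ Ioo 0 T, y + t • w ∈ Ω) :
    ENNReal.ofReal ((v (y + T • w) - v y) ^ 2) ≤
      ENNReal.ofReal (T * ‖w‖ ^ 2) * ∫⁻ t in Ioo 0 T, energyDensity Ω v (y + t • w) := by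
  obtain ⟨A, hA⟩ := hv.bounded_gradient
  have hline : Continuous fun t : ℝ => y + t • w := by fun_prop
  have hcl : ∀ t ∈ Icc 0 T, y + t • w ∈ closure Ω := by
    intro t ht
    rw [← closure_Ioo hT.ne] at ht
    exact map_mem_closure (f := fun t : ℝ => y + t • w) hline ht hseg
  have hderiv : ∀ t ∈ Ioo 0 T, HasDerivAt (fun t : ℝ => v (y + t • w))
      (inner ℝ (gradient v (y + t • w)) w) t := by
    intro t ht
    have h1 : HasFDerivAt v (fderiv ℝ v (y + t • w)) (y + t • w) :=
      ((hv.contDiffOn.contDiffAt (hΩ.mem_nhds (hseg t ht))).differentiableAt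
        one_ne_zero).hasFDerivAt
    have h2 : HasDerivAt (fun t : ℝ => y + t • w) w t := by
      simpa using ((hasDerivAt_id t).smul_const w).const_add y
    rw [inner_gradient_eq_fderiv]
    exact h1.comp_hasDerivAt t h2
  have hcont : ContinuousOn (fun t : ℝ => inner ℝ (gradient v (y + t • w)) w) (Ioo 0 T) :=
    ((hv.continuousOn_gradient hΩ).comp hline.continuousOn hseg).inner continuousOn_const
  obtain ⟨hint, hle⟩ := sq_sub_le_integral_sq_deriv (f := fun t : ℝ => v (y + t • w)) (A := A * ‖w‖)
    hT (hv.continuousOn.comp hline.continuousOn hcl) hderiv hcont fun t ht => by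
      refine (abs_real_inner_le_norm _ _).trans ?_
      have := hA _ (hseg t ht)
      gcongr
  simp only [zero_smul, add_zero] at hle
  refine (ENNReal.ofReal_le_ofReal hle).trans ?_
  rw [ENNReal.ofReal_mul hT.le, ENNReal.ofReal_mul hT.le, mul_assoc,
    ofReal_integral_eq_lintegral_ofReal hint (.of_forall fun t => sq_nonneg _)]
  gcongr
  rw [← lintegral_const_mul' _ _ ENNReal.ofReal_ne_top]
  refine setLIntegral_mono' measurableSet_Ioo fun t ht => ?_
  rw [energyDensity, indicator_of_mem (hseg t ht), ← ENNReal.ofReal_mul (by positivity)]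
  refine ENNReal.ofReal_le_ofReal ?_
  rw [← sq_abs, mul_comm, ← mul_pow]
  gcongr
  exact abs_real_inner_le_norm _ _

theorem measurable_lintegral_energyDensity (hv : IsDirichletTest Ω ΓD v) (hΩ : IsOpen Ω)
    (w : EuclideanSpace ℝ (Fin n)) (T : ℝ) :
    Measurable fun y => ∫⁻ t in Ioo 0 T, energyDensity Ω v (y + t • w) :=
  Measurable.lintegral_prod_right' (f := fun p : EuclideanSpace ℝ (Fin n) × ℝ =>
    energyDensity Ω v (p.1 + p.2 • w)) ((hv.measurable_energyDensity hΩ).comp (by fun_prop))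

/-- By Tonelli, integrate first in `y`: translation invariance makes each inner integral at most the
total energy. Extending the density by zero lets the translates leave `Ω`. -/
theorem lintegral_lintegral_energyDensity_le (hv : IsDirichletTest Ω ΓD v) (hΩ : IsOpen Ω)
    (S : Set (EuclideanSpace ℝ (Fin n))) (w : EuclideanSpace ℝ (Fin n)) (T : ℝ) :
    ∫⁻ y in S, ∫⁻ t in Ioo 0 T, energyDensity Ω v (y + t • w) ≤
      ENNReal.ofReal T * ∫⁻ x in Ω, ENNReal.ofReal (‖gradient v x‖ ^ 2) := by
  refine (setLIntegral_le_lintegral _ _).trans ?_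
  rw [lintegral_lintegral_swap]
  · simp only [lintegral_add_right_eq_self]
    rw [lintegral_const, energyDensity, lintegral_indicator hΩ.measurableSet]
    simp [mul_comm]
  · exact ((hv.measurable_energyDensity hΩ).comp (by fun_prop)).aemeasurable

/-- The square integrals of `v` over a set and over a translate differ by the energy at most. -/
theorem setLIntegral_sq_le_of_translate (hv : IsDirichletTest Ω ΓD v) (hΩ : IsOpen Ω)
    {S S' : Set (EuclideanSpace ℝ (Fin n))} (hS : MeasurableSet S) (hS' : MeasurableSet S')
    {w : EuclideanSpace ℝ (Fin n)} (hseg : ∀ y ∈ S, ∀ t ∈ Ioo (0 : ℝ) 1, y + t • w ∈ Ω)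
    (hmaps : ∀ y ∈ S, y + w ∈ S') :
    ∫⁻ x in S, ENNReal.ofReal (v x ^ 2) ≤ 2 * (∫⁻ x in S', ENNReal.ofReal (v x ^ 2)) +
      2 * ENNReal.ofReal (‖w‖ ^ 2) * ∫⁻ x in Ω, ENNReal.ofReal (‖gradient v x‖ ^ 2) := by
  have hpt : ∀ y ∈ S, ENNReal.ofReal (v y ^ 2) ≤ 2 * ENNReal.ofReal (v (y + w) ^ 2) +
      2 * ENNReal.ofReal (‖w‖ ^ 2) * ∫⁻ t in Ioo (0 : ℝ) 1, energyDensity Ω v (y + t • w) := by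
    intro y hy
    have h1 := hv.ofReal_sq_sub_le hΩ one_pos (hseg y hy)
    rw [one_smul, one_mul] at h1
    have h2 : v y ^ 2 ≤ 2 * v (y + w) ^ 2 + 2 * (v (y + w) - v y) ^ 2 := by
      nlinarith [sq_nonneg (2 * v (y + w) - v y)]
    refine (ENNReal.ofReal_le_ofReal h2).trans ?_
    rw [ENNReal.ofReal_add (by positivity) (by positivity), ENNReal.ofReal_mul (by norm_num),
      ENNReal.ofReal_mul (by norm_num), mul_assoc]
    simp only [ENNReal.ofReal_ofNat]
    gcongr
  have htrans : ∫⁻ y in S, ENNReal.ofReal (v (y + w) ^ 2) ≤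
      ∫⁻ x in S', ENNReal.ofReal (v x ^ 2) := by
    rw [← lintegral_indicator hS, ← lintegral_indicator hS',
      ← lintegral_add_right_eq_self (S'.indicator _) w]
    refine lintegral_mono fun y => ?_
    by_cases hy : y ∈ S
    · rw [indicator_of_mem hy, indicator_of_mem (hmaps y hy)]
    · rw [indicator_of_notMem hy]
      exact zero_le
  refine (setLIntegral_mono' hS hpt).trans ?_
  rw [lintegral_add_right _ ((hv.measurable_lintegral_energyDensity hΩ w 1).const_mul _),
    lintegral_const_mul' _ _ (by simp),
    lintegral_const_mul' _ _ (ENNReal.mul_ne_top (by simp) ENNReal.ofReal_ne_top)]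
  have henergy := hv.lintegral_lintegral_energyDensity_le hΩ S w 1
  rw [ENNReal.ofReal_one, one_mul] at henergy
  exact add_le_add (by gcongr) (mul_le_mul' le_rfl henergy)

end IsDirichletTest

/-- The Poincaré inequality holds on the set `S`, with the energy of all of `Ω` on the right. -/
def PoincareOn {n : ℕ} (Ω ΓD S : Set (EuclideanSpace ℝ (Fin n))) : Prop :=
  ∃ C : ℝ≥0∞, C ≠ ⊤ ∧ ∀ v, IsDirichletTest Ω ΓD v →
    ∫⁻ x in S, ENNReal.ofReal (v x ^ 2) ≤
      C * ∫⁻ x in Ω, ENNReal.ofReal (‖gradient v x‖ ^ 2)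

namespace PoincareOn

variable {n : ℕ} {Ω ΓD ΓN S S' : Set (EuclideanSpace ℝ (Fin n))}

theorem mono (h : PoincareOn Ω ΓD S') (hS : S ⊆ S') : PoincareOn Ω ΓD S := by
  obtain ⟨C, hC, h⟩ := h
  exact ⟨C, hC, fun v hv => (lintegral_mono_set hS).trans (h v hv)⟩

theorem union (h : PoincareOn Ω ΓD S) (h' : PoincareOn Ω ΓD S') : PoincareOn Ω ΓD (S ∪ S') := by
  obtain ⟨C, hC, h⟩ := h
  obtain ⟨C', hC', h'⟩ := h'
  refine ⟨C + C', ENNReal.add_ne_top.2 ⟨hC, hC'⟩, fun v hv => ?_⟩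
  rw [add_mul]
  exact (lintegral_union_le _ _ _).trans (add_le_add (h v hv) (h' v hv))

/-- This is the propagation step: the inequality passes from `S'` to a set whose translate by `w`
lies in `S'`, provided that the joining segments stay in `Ω`. -/
theorem of_translate (h : PoincareOn Ω ΓD S') (hΩ : IsOpen Ω) (hS : MeasurableSet S)
    (hS' : MeasurableSet S') {w : EuclideanSpace ℝ (Fin n)}
    (hseg : ∀ y ∈ S, ∀ t ∈ Ioo (0 : ℝ) 1, y + t • w ∈ Ω) (hmaps : ∀ y ∈ S, y + w ∈ S') :
    PoincareOn Ω ΓD S := by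
  obtain ⟨C, hC, h⟩ := h
  refine ⟨2 * C + 2 * ENNReal.ofReal (‖w‖ ^ 2), ENNReal.add_ne_top.2
    ⟨ENNReal.mul_ne_top (by simp) hC, ENNReal.mul_ne_top (by simp) ENNReal.ofReal_ne_top⟩,
    fun v hv => (hv.setLIntegral_sq_le_of_translate hΩ hS hS' hseg hmaps).trans ?_⟩
  rw [add_mul, mul_assoc 2 C]
  gcongr
  exact h v hv

end PoincareOn

namespace IsBoundaryChart

variable {n : ℕ} {Ω : Set (EuclideanSpace ℝ (Fin n))} {x e : EuclideanSpace ℝ (Fin n)} {r : ℝ}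
  {γ : EuclideanSpace ℝ (Fin n) → ℝ}

theorem heightBelow_center (h : IsBoundaryChart Ω x r e γ) (hΩ : IsOpen Ω)
    (hx : x ∈ frontier Ω) : heightBelow e γ x = 0 := by
  rw [hΩ.frontier_eq] at hx
  have hxb : x ∈ Metric.ball x r := Metric.mem_ball_self h.radius_pos
  refine le_antisymm (not_lt.1 fun hpos => hx.2 ((h.mem_iff_heightBelow_pos hxb).2 hpos)) ?_
  by_contra hneg
  have hev : ∀ᶠ y in 𝓝 x, heightBelow e γ y < 0 ∧ y ∈ Metric.ball x r :=
    (h.contDiff_heightBelow.continuous.continuousAt.eventually_lt continuousAt_const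
      (not_le.1 hneg)).and (Metric.isOpen_ball.mem_nhds hxb)
  obtain ⟨y, hyΩ, hy1, hy2⟩ := ((mem_closure_iff_frequently.1 hx.1).and_eventually hev).exists
  exact absurd ((h.mem_iff_heightBelow_pos hy2).1 hyΩ) (not_lt.2 hy1.le)

end IsBoundaryChart

section

variable {n : ℕ} {Ω ΓD ΓN : Set (EuclideanSpace ℝ (Fin n))}

/-- The Poincaré inequality near a point of `ΓD`, by integration along the chart direction. -/
theorem exists_poincareOn_of_mem_left (hΩ : IsSmoothBoundedDomain Ω)
    (hΓ : IsBoundarySplitting Ω ΓD ΓN) {x : EuclideanSpace ℝ (Fin n)} (hx : x ∈ ΓD) :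
    ∃ ρ > 0, PoincareOn Ω ΓD (Metric.ball x ρ ∩ Ω) := by
  have ho := hΩ.isOpen
  have hxf : x ∈ frontier Ω := hΓ.union_eq ▸ Or.inl hx
  obtain ⟨r, e, γ, hchart⟩ := hΩ.smooth_boundary x hxf
  obtain ⟨r', hr', hN⟩ := Metric.isOpen_iff.1 hΓ.isClosed_right.isOpen_compl x
    (hΓ.disjoint.notMem_of_mem_left hx)
  -- Within distance `R` of `x` the chart is valid and there are no points of `ΓN`. Half of `R`
  -- bounds the distance of `y` from `x`, the other half the length of the vertical segment.
  set R := min r r' with hR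
  have hR0 : 0 < R := lt_min hchart.radius_pos hr'
  have hd0 := hchart.heightBelow_center ho hxf
  obtain ⟨ρ₁, hρ₁, hball⟩ := Metric.isOpen_iff.1
    (isOpen_lt hchart.contDiff_heightBelow.continuous (continuous_const (y := R / 2))) x
    (show heightBelow e γ x < R / 2 by rw [hd0]; exact half_pos hR0)
  refine ⟨min ρ₁ (R / 2), lt_min hρ₁ (half_pos hR0), ENNReal.ofReal (R / 2) *
    ENNReal.ofReal (R / 2), ENNReal.mul_ne_top ENNReal.ofReal_ne_top ENNReal.ofReal_ne_top,
    fun v hv => ?_⟩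
  have hpt : ∀ y ∈ Metric.ball x (min ρ₁ (R / 2)) ∩ Ω, ENNReal.ofReal (v y ^ 2) ≤
      ENNReal.ofReal (R / 2) *
        ∫⁻ t in Ioo (0 : ℝ) (R / 2), energyDensity Ω v (y + t • e) := by
    rintro y ⟨hyb, hyΩ⟩
    have hyR : dist y x < R / 2 := lt_of_lt_of_le hyb (min_le_right _ _)
    set T := heightBelow e γ y with hT
    have hTR : T < R / 2 := hball (Metric.ball_subset_ball (min_le_left _ _) hyb)
    have hmem : ∀ t, 0 ≤ t → t ≤ T → y + t • e ∈ Metric.ball x R := by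
      intro t ht0 htT
      have : dist (y + t • e) y = t := by
        rw [dist_self_add_left, norm_smul, hchart.norm_dir, mul_one, Real.norm_of_nonneg ht0]
      exact lt_of_le_of_lt (dist_triangle _ y _) (by linarith)
    have hmem' : ∀ t, 0 ≤ t → t ≤ T → y + t • e ∈ Metric.ball x r := fun t h0 hT' =>
      Metric.ball_subset_ball (min_le_left _ _) (hmem t h0 hT')
    have hTpos : 0 < T := by
      by_contra hneg
      refine hneg ((hchart.mem_iff_heightBelow_pos ?_).1 hyΩ)
      exact lt_of_lt_of_le (lt_of_lt_of_le hyR (half_le_self hR0.le)) (min_le_left _ _)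
    have hseg : ∀ t ∈ Ioo 0 T, y + t • e ∈ Ω := by
      intro t ht
      rw [hchart.mem_iff_heightBelow_pos (hmem' t ht.1.le ht.2.le), hchart.heightBelow_add_smul]
      exact sub_pos.2 ht.2
    -- The segment leaves `Ω` at height zero, hence at a boundary point; being away from `ΓN`, it
    -- lies on `ΓD`, where `v` vanishes.
    have hend : y + T • e ∈ ΓD := by
      have hcl : y + T • e ∈ closure Ω := by
        have hcont : Continuous fun t : ℝ => y + t • e := by fun_prop
        refine map_mem_closure (f := fun t : ℝ => y + t • e) hcont ?_ hseg
        rw [closure_Ioo hTpos.ne]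
        exact ⟨hTpos.le, le_rfl⟩
      have hnot : y + T • e ∉ Ω := by
        rw [hchart.mem_iff_heightBelow_pos (hmem' T hTpos.le le_rfl), hchart.heightBelow_add_smul]
        simp [hT]
      have hfr : y + T • e ∈ ΓD ∪ ΓN := by
        rw [← hΓ.union_eq, ho.frontier_eq]
        exact ⟨hcl, hnot⟩
      exact hfr.resolve_right
        (hN (Metric.ball_subset_ball (min_le_right _ _) (hmem T hTpos.le le_rfl)))
    have h1 := hv.ofReal_sq_sub_le ho hTpos hseg
    rw [hv.eq_zero _ hend, zero_sub, neg_sq, hchart.norm_dir, one_pow, mul_one] at h1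
    refine h1.trans (mul_le_mul' (ENNReal.ofReal_le_ofReal hTR.le) ?_)
    exact lintegral_mono_set (Ioo_subset_Ioo_right hTR.le)
  refine (setLIntegral_mono' (Metric.isOpen_ball.inter ho).measurableSet hpt).trans ?_
  rw [lintegral_const_mul' _ _ ENNReal.ofReal_ne_top, mul_assoc]
  exact mul_le_mul' le_rfl (hv.lintegral_lintegral_energyDensity_le ho _ e _)

/-- A connectedness argument: the set of good centres is open, meets `Ω` near `ΓD`, and is closed
relative to `Ω`, because a small ball can be translated onto a ball around a nearby good centre. -/
theorem exists_poincareOn_of_mem (hΩ : IsSmoothBoundedDomain Ω)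
    (hΓ : IsBoundarySplitting Ω ΓD ΓN) {x : EuclideanSpace ℝ (Fin n)} (hx : x ∈ Ω) :
    ∃ ρ > 0, PoincareOn Ω ΓD (Metric.ball x ρ ∩ Ω) := by
  have ho := hΩ.isOpen
  set U : Set (EuclideanSpace ℝ (Fin n)) :=
    {x | ∃ ρ > 0, PoincareOn Ω ΓD (Metric.ball x ρ ∩ Ω)} with hU
  have hUo : IsOpen U := by
    refine Metric.isOpen_iff.2 ?_
    rintro y ⟨ρ, hρ, hP⟩
    refine ⟨ρ, hρ, fun z hz => ⟨ρ - dist z y, sub_pos.2 hz, hP.mono ?_⟩⟩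
    exact inter_subset_inter_left _ (Metric.ball_subset_ball' (by linarith))
  have hne : (Ω ∩ U).Nonempty := by
    obtain ⟨p, hp⟩ := hΓ.isConnected_left.nonempty
    have hpU : p ∈ U := exists_poincareOn_of_mem_left hΩ hΓ hp
    have hpf : p ∈ frontier Ω := hΓ.union_eq ▸ Or.inl hp
    obtain ⟨z, hz, hzΩ⟩ := mem_closure_iff.1 (frontier_subset_closure hpf) U hUo hpU
    exact ⟨z, hzΩ, hz⟩
  refine hΩ.isConnected.isPreconnected.subset_of_closure_inter_subset hUo hne ?_ hx
  rintro y ⟨hyU, hyΩ⟩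
  obtain ⟨R, hR, hball⟩ := Metric.isOpen_iff.1 ho y hyΩ
  obtain ⟨z, ⟨ρ, hρ, hP⟩, hzy⟩ := Metric.mem_closure_iff.1 hyU (R / 2) (half_pos hR)
  refine ⟨min ρ (R / 2), lt_min hρ (half_pos hR), ?_⟩
  refine hP.of_translate ho (Metric.isOpen_ball.inter ho).measurableSet
    (Metric.isOpen_ball.inter ho).measurableSet (w := z - y) ?_ ?_
  · rintro p ⟨hp, -⟩ t ht
    refine hball ?_
    have h1 : dist p y < R / 2 := lt_of_lt_of_le hp (min_le_right _ _)
    have h2 : dist (p + t • (z - y)) p ≤ dist y z := by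
      rw [dist_self_add_left, norm_smul, ← dist_eq_norm, dist_comm z y,
        Real.norm_of_nonneg ht.1.le]
      exact mul_le_of_le_one_left dist_nonneg ht.2.le
    exact lt_of_le_of_lt (dist_triangle _ p _) (by linarith)
  · rintro p ⟨hp, -⟩
    have h1 : dist (p + (z - y)) z = dist p y := by
      rw [dist_eq_norm, dist_eq_norm]
      congr 1
      abel
    have h2 : dist p y < min ρ (R / 2) := hp
    refine ⟨?_, hball ?_⟩
    · rw [Metric.mem_ball, h1]
      exact h2.trans_le (min_le_left _ _)
    · rw [Metric.mem_ball]
      refine lt_of_le_of_lt (dist_triangle _ z _) ?_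
      rw [h1, dist_comm z y]
      linarith [h2.trans_le (min_le_right _ _)]

/-- Translating by `-(r / 2) • e` moves a neighbourhood of the boundary point into `Ω`, near an
interior point where the inequality is known. No boundary condition is needed at `x`. -/
theorem exists_poincareOn_of_mem_frontier (hΩ : IsSmoothBoundedDomain Ω)
    (hΓ : IsBoundarySplitting Ω ΓD ΓN) {x : EuclideanSpace ℝ (Fin n)} (hx : x ∈ frontier Ω) :
    ∃ ρ > 0, PoincareOn Ω ΓD (Metric.ball x ρ ∩ Ω) := by
  have ho := hΩ.isOpen
  obtain ⟨r, e, γ, hchart⟩ := hΩ.smooth_boundary x hx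
  have hr := hchart.radius_pos
  have hd0 := hchart.heightBelow_center ho hx
  have hshift : ∀ y ∈ Metric.ball x (r / 2), 0 ≤ heightBelow e γ y → ∀ t, 0 < t → t ≤ r / 2 →
      y + (-t) • e ∈ Ω := by
    intro y hy hy0 t ht ht'
    have hb : y + (-t) • e ∈ Metric.ball x r := by
      have h1 : dist (y + (-t) • e) y = t := by
        rw [dist_self_add_left, norm_smul, hchart.norm_dir, mul_one, norm_neg,
          Real.norm_of_nonneg ht.le]
      have h2 : dist y x < r / 2 := hy
      exact lt_of_le_of_lt (dist_triangle _ y _) (by linarith)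
    rw [hchart.mem_iff_heightBelow_pos hb, hchart.heightBelow_add_smul]
    linarith
  obtain ⟨ρ, hρ, hP⟩ := exists_poincareOn_of_mem hΩ hΓ
    (hshift x (Metric.mem_ball_self (half_pos hr)) hd0.ge (r / 2) (half_pos hr) le_rfl)
  refine ⟨min ρ (r / 2), lt_min hρ (half_pos hr), ?_⟩
  have hheight : ∀ y ∈ Metric.ball x (min ρ (r / 2)) ∩ Ω,
      y ∈ Metric.ball x (r / 2) ∧ 0 ≤ heightBelow e γ y := by
    rintro y ⟨hy, hyΩ⟩
    have hy' := Metric.ball_subset_ball (min_le_right _ _) hy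
    exact ⟨hy', ((hchart.mem_iff_heightBelow_pos
      (Metric.ball_subset_ball (half_le_self hr.le) hy')).1 hyΩ).le⟩
  refine hP.of_translate ho (Metric.isOpen_ball.inter ho).measurableSet
    (Metric.isOpen_ball.inter ho).measurableSet (w := (-(r / 2)) • e) ?_ ?_
  · intro y hy t ht
    obtain ⟨hy1, hy2⟩ := hheight y hy
    have := hshift y hy1 hy2 (t * (r / 2)) (mul_pos ht.1 (half_pos hr))
      (mul_le_of_le_one_left (half_pos hr).le ht.2.le)
    rwa [smul_smul, mul_neg]
  · intro y hy
    obtain ⟨hy1, hy2⟩ := hheight y hy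
    refine ⟨?_, hshift y hy1 hy2 _ (half_pos hr) le_rfl⟩
    rw [Metric.mem_ball, dist_add_right]
    exact lt_of_lt_of_le hy.1 (min_le_left _ _)

theorem poincareOn_self (hΩ : IsSmoothBoundedDomain Ω) (hΓ : IsBoundarySplitting Ω ΓD ΓN) :
    PoincareOn Ω ΓD Ω := by
  have h := hΩ.isBounded.isCompact_closure.induction_on
    (p := fun S => PoincareOn Ω ΓD (S ∩ Ω)) ?_ ?_ ?_ ?_
  · rwa [inter_eq_right.2 subset_closure] at h
  · exact ⟨0, by simp, fun v _ => by simp⟩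
  · exact fun S T hST hT => hT.mono (inter_subset_inter_left _ hST)
  · intro S T hS hT
    rw [union_inter_distrib_right]
    exact hS.union hT
  · intro x hx
    obtain ⟨ρ, hρ, hP⟩ : ∃ ρ > 0, PoincareOn Ω ΓD (Metric.ball x ρ ∩ Ω) := by
      by_cases hxΩ : x ∈ Ω
      · exact exists_poincareOn_of_mem hΩ hΓ hxΩ
      · refine exists_poincareOn_of_mem_frontier hΩ hΓ ?_
        rw [hΩ.isOpen.frontier_eq]
        exact ⟨hx, hxΩ⟩
    exact ⟨Metric.ball x ρ, mem_nhdsWithin_of_mem_nhds (Metric.ball_mem_nhds x hρ), hP⟩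

theorem IsDirichletTest.hasFiniteH1Norm {v : EuclideanSpace ℝ (Fin n) → ℝ}
    (hv : IsDirichletTest Ω ΓD v) (hΩ : IsOpen Ω) (hb : Bornology.IsBounded Ω) :
    HasFiniteH1Norm Ω v := by
  have hfin : IsFiniteMeasure (volume.restrict Ω) := ⟨by simpa using hb.measure_lt_top⟩
  obtain ⟨A, hA⟩ := hv.bounded_gradient
  obtain ⟨B, hB⟩ := hb.isCompact_closure.exists_bound_of_continuousOn hv.continuousOn
  exact ⟨.of_bound ((hv.continuousOn.mono subset_closure).aestronglyMeasurable hΩ.measurableSet) B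
      ((ae_restrict_iff' hΩ.measurableSet).2 (.of_forall fun x hx => hB x (subset_closure hx))),
    .of_bound ((hv.continuousOn_gradient hΩ).aestronglyMeasurable hΩ.measurableSet) A
      ((ae_restrict_iff' hΩ.measurableSet).2 (.of_forall hA))⟩

theorem HasFiniteH1Norm.integrable_sq {v : EuclideanSpace ℝ (Fin n) → ℝ}
    (hv : HasFiniteH1Norm Ω v) : IntegrableOn (fun x => v x ^ 2) Ω :=
  hv.1.integrable_sq

theorem HasFiniteH1Norm.integrable_norm_gradient_sq {v : EuclideanSpace ℝ (Fin n) → ℝ}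
    (hv : HasFiniteH1Norm Ω v) : IntegrableOn (fun x => ‖gradient v x‖ ^ 2) Ω :=
  hv.2.norm.integrable_sq

/-- The Poincaré inequality for functions that vanish on `ΓD`. -/
theorem exists_poincare (hΩ : IsSmoothBoundedDomain Ω) (hΓ : IsBoundarySplitting Ω ΓD ΓN) :
    ∃ C : ℝ, 0 ≤ C ∧ ∀ v, IsDirichletTest Ω ΓD v →
      ∫ x in Ω, v x ^ 2 ≤ C * ∫ x in Ω, ‖gradient v x‖ ^ 2 := by
  obtain ⟨C, hC, hP⟩ := poincareOn_self hΩ hΓ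
  refine ⟨C.toReal, ENNReal.toReal_nonneg, fun v hv => ?_⟩
  have hH1 := hv.hasFiniteH1Norm hΩ.isOpen hΩ.isBounded
  have h := hP v hv
  rw [← ofReal_integral_eq_lintegral_ofReal hH1.integrable_sq (.of_forall fun _ => sq_nonneg _),
    ← ofReal_integral_eq_lintegral_ofReal hH1.integrable_norm_gradient_sq
      (.of_forall fun _ => sq_nonneg _), ← ENNReal.ofReal_toReal hC,
    ← ENNReal.ofReal_mul ENNReal.toReal_nonneg] at h
  exact (ENNReal.ofReal_le_ofReal_iff (mul_nonneg ENNReal.toReal_nonneg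
    (integral_nonneg fun _ => sq_nonneg _))).1 h

end

/-! ### Energy estimates and the monotone step -/

theorem integrable_inner_of_memLp_two {α H : Type*} [MeasurableSpace α] {μ : Measure α}
    [NormedAddCommGroup H] [InnerProductSpace ℝ H] {f g : α → H} (hf : MemLp f 2 μ)
    (hg : MemLp g 2 μ) : Integrable (fun x => inner ℝ (f x) (g x)) μ :=
  (hf.norm.integrable_mul hg.norm).mono' (hf.1.inner hg.1)
    (.of_forall fun _ => norm_inner_le_norm _ _)

theorem abs_integral_inner_le {α H : Type*} [MeasurableSpace α] {μ : Measure α}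
    [NormedAddCommGroup H] [InnerProductSpace ℝ H] {f g : α → H} (hf : MemLp f 2 μ)
    (hg : MemLp g 2 μ) :
    |∫ x, inner ℝ (f x) (g x) ∂μ| ≤ √(∫ x, ‖f x‖ ^ 2 ∂μ) * √(∫ x, ‖g x‖ ^ 2 ∂μ) := by
  have hinner : ∀ {f g : α → H} (hf : MemLp f 2 μ) (hg : MemLp g 2 μ),
      inner ℝ (hf.toLp f) (hg.toLp g) = ∫ x, inner ℝ (f x) (g x) ∂μ := by
    intro f g hf hg
    rw [L2.inner_def]
    refine integral_congr_ae ?_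
    filter_upwards [hf.coeFn_toLp, hg.coeFn_toLp] with x h1 h2
    rw [h1, h2]
  have hnorm : ∀ {f : α → H} (hf : MemLp f 2 μ), √(∫ x, ‖f x‖ ^ 2 ∂μ) = ‖hf.toLp f‖ := by
    intro f hf
    rw [← Real.sqrt_sq (norm_nonneg (hf.toLp f)), ← real_inner_self_eq_norm_sq, hinner hf hf]
    simp only [real_inner_self_eq_norm_sq]
  rw [hnorm hf, hnorm hg, ← hinner hf hg]
  exact abs_real_inner_le_norm _ _

theorem integral_norm_sq_pos {n : ℕ} {H : Type*} [NormedAddCommGroup H]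
    {Ω : Set (EuclideanSpace ℝ (Fin n))} (hΩ : IsOpen Ω) {f : EuclideanSpace ℝ (Fin n) → H}
    (hf : ContinuousOn f Ω) (hi : IntegrableOn (fun x => ‖f x‖ ^ 2) Ω)
    {x : EuclideanSpace ℝ (Fin n)} (hx : x ∈ Ω) (hfx : f x ≠ 0) :
    0 < ∫ x in Ω, ‖f x‖ ^ 2 := by
  refine (integral_nonneg fun x => sq_nonneg _).lt_of_ne' fun h0 => hfx ?_
  rw [integral_eq_zero_iff_of_nonneg (fun x => sq_nonneg _) hi] at h0
  have := Measure.eqOn_open_of_ae_eq h0 hΩ (hf.norm.pow 2) continuousOn_const hx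
  simpa using this

section

variable {n : ℕ} {Ω ΓD ΓN : Set (EuclideanSpace ℝ (Fin n))}
  {u v f φ : EuclideanSpace ℝ (Fin n) → ℝ}

theorem sq_normL2 : normL2 Ω v ^ 2 = ∫ x in Ω, v x ^ 2 :=
  Real.sq_sqrt (integral_nonneg fun _ => sq_nonneg _)

theorem sq_normGradL2 : normGradL2 Ω v ^ 2 = ∫ x in Ω, ‖gradient v x‖ ^ 2 :=
  Real.sq_sqrt (integral_nonneg fun _ => sq_nonneg _)

theorem rayleigh_mul_sq_normL2 (h : 0 < normL2 Ω v) :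
    rayleigh Ω v * normL2 Ω v ^ 2 = normGradL2 Ω v ^ 2 := by
  have h2 : normL2 Ω v ^ 2 ≠ 0 := (pow_pos h 2).ne'
  rw [sq_normL2] at h2
  rw [rayleigh, sq_normL2, sq_normGradL2, div_mul_cancel₀ _ h2]

theorem abs_integral_mul_le (hu : MemLp u 2 (volume.restrict Ω))
    (hv : MemLp v 2 (volume.restrict Ω)) :
    |∫ x in Ω, u x * v x| ≤ normL2 Ω u * normL2 Ω v := by
  have h := abs_integral_inner_le hu hv
  simpa [normL2, mul_comm] using h

theorem IsClassicalMixedSolution.isDirichletTest (hΩ : IsSmoothBoundedDomain Ω)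
    (hv : IsClassicalMixedSolution Ω ΓD ΓN f v) : IsDirichletTest Ω ΓD v := by
  obtain ⟨hv2, hvc, -, hvD, G, hGc, hGv, -⟩ := hv
  obtain ⟨A, hA⟩ := hΩ.isBounded.isCompact_closure.exists_bound_of_continuousOn hGc
  exact ⟨hv2.of_le (by norm_num), hvc, hvD,
    A, fun x hx => hGv x hx ▸ hA x (subset_closure hx)⟩

/-- If the gradient vanished throughout `Ω`, so would the Laplacian, and with it `f`. -/
theorem IsClassicalMixedSolution.exists_gradient_ne_zero (hΩ : IsOpen Ω)
    (hv : IsClassicalMixedSolution Ω ΓD ΓN f v) {x : EuclideanSpace ℝ (Fin n)} (hx : x ∈ Ω)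
    (hfx : f x ≠ 0) : ∃ y ∈ Ω, gradient v y ≠ 0 := by
  by_contra! hzero
  have hev : gradient v =ᶠ[𝓝 x] fun _ => 0 := by
    filter_upwards [hΩ.mem_nhds hx] with y hy using hzero y hy
  refine hfx ?_
  rw [← hv.2.2.1 x hx, ← divergence_gradient hΩ hv.1 hx, divergence_congr hev]
  simp [divergence]

/-- A solution with non-trivial right-hand side has positive norm and positive energy. -/
theorem IsClassicalMixedSolution.norms_pos (hΩ : IsSmoothBoundedDomain Ω)
    (hv : IsClassicalMixedSolution Ω ΓD ΓN f v) {x : EuclideanSpace ℝ (Fin n)} (hx : x ∈ Ω)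
    (hfx : f x ≠ 0) : 0 < normL2 Ω v ∧ 0 < normGradL2 Ω v ∧ ∃ y ∈ Ω, v y ≠ 0 := by
  have hT := hv.isDirichletTest hΩ
  have hH1 := hT.hasFiniteH1Norm hΩ.isOpen hΩ.isBounded
  obtain ⟨y, hy, hgy⟩ := hv.exists_gradient_ne_zero hΩ.isOpen hx hfx
  obtain ⟨z, hz, hvz⟩ : ∃ z ∈ Ω, v z ≠ 0 := by
    by_contra! hzero
    have hev : v =ᶠ[𝓝 y] fun _ => 0 := by
      filter_upwards [hΩ.isOpen.mem_nhds hy] with z hz using hzero z hz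
    refine hgy ?_
    rw [gradient, hev.fderiv_eq]
    simp
  refine ⟨Real.sqrt_pos.2 ?_, Real.sqrt_pos.2 ?_, z, hz, hvz⟩
  · simpa using integral_norm_sq_pos hΩ.isOpen (hT.continuousOn.mono subset_closure)
      (by simpa using hH1.integrable_sq) hz hvz
  · exact integral_norm_sq_pos hΩ.isOpen (hT.continuousOn_gradient hΩ.isOpen)
      hH1.integrable_norm_gradient_sq hy hgy

theorem IsClassicalMixedSolution.weak_form (hΩ : IsSmoothBoundedDomain Ω)
    (hΓ : IsBoundarySplitting Ω ΓD ΓN) {c : ℝ}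
    (hv : IsClassicalMixedSolution Ω ΓD ΓN (fun x => c * u x) v)
    (hu : MemLp u 2 (volume.restrict Ω)) (hφ : IsDirichletTest Ω ΓD φ) :
    ∫ x in Ω, inner ℝ (gradient v x) (gradient φ x) = c * ∫ x in Ω, u x * φ x := by
  have hfin : IsFiniteMeasure (volume.restrict Ω) :=
    ⟨by simpa using hΩ.isBounded.measure_lt_top⟩
  have hi : IntegrableOn u Ω := hu.integrable (by norm_num)
  have hig : IntegrableOn (gradient φ) Ω :=
    (hφ.hasFiniteH1Norm hΩ.isOpen hΩ.isBounded).2.integrable (by norm_num)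
  rw [hv.integral_inner_gradient hΩ hΓ (hi.const_mul c) hφ.contDiffOn hφ.continuousOn hφ.eq_zero
    hig, ← integral_const_mul]
  simp only [mul_assoc]

/-- The solution is tested with itself, and Cauchy-Schwarz bounds the right-hand side. -/
theorem IsClassicalMixedSolution.sq_normGradL2_le (hΩ : IsSmoothBoundedDomain Ω)
    (hΓ : IsBoundarySplitting Ω ΓD ΓN) {c : ℝ} (hc : 0 ≤ c)
    (hv : IsClassicalMixedSolution Ω ΓD ΓN (fun x => c * u x) v)
    (hu : MemLp u 2 (volume.restrict Ω)) :
    normGradL2 Ω v ^ 2 ≤ c * (normL2 Ω u * normL2 Ω v) := by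
  have hT := hv.isDirichletTest hΩ
  have h := hv.weak_form hΩ hΓ hu hT
  simp only [real_inner_self_eq_norm_sq] at h
  rw [sq_normGradL2, h]
  gcongr
  exact (le_abs_self _).trans
    (abs_integral_mul_le hu (hT.hasFiniteH1Norm hΩ.isOpen hΩ.isBounded).1)

theorem isDirichletTest_of_hasCompactSupport (hφ : ContDiff ℝ ∞ φ) (hc : HasCompactSupport φ)
    (hd : Disjoint (tsupport φ) ΓD) : IsDirichletTest Ω ΓD φ where
  contDiffOn := (hφ.of_le (by simp)).contDiffOn
  continuousOn := hφ.continuous.continuousOn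
  eq_zero x hx := image_eq_zero_of_notMem_tsupport fun h => hd.notMem_of_mem_left h hx
  bounded_gradient := by
    obtain ⟨A, hA⟩ := (hc.fderiv (𝕜 := ℝ)).exists_bound_of_continuous
      (hφ.continuous_fderiv (by simp))
    refine ⟨A, fun x _ => ?_⟩
    rw [gradient, LinearIsometryEquiv.norm_map]
    exact hA x

/-- The weak form holds for test functions of class `C¹` that vanish on `ΓD` in the sense
of `H¹`. -/
theorem VanishesOnDirichletPart.weak_form (hΩ : IsSmoothBoundedDomain Ω)
    (hΓ : IsBoundarySplitting Ω ΓD ΓN) {c : ℝ} (hc : 0 ≤ c)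
    (hv : IsClassicalMixedSolution Ω ΓD ΓN (fun x => c * u x) v)
    (hu : MemLp u 2 (volume.restrict Ω)) {w : EuclideanSpace ℝ (Fin n) → ℝ}
    (hw : VanishesOnDirichletPart Ω ΓD w) :
    ∫ x in Ω, inner ℝ (gradient v x) (gradient w x) = c * ∫ x in Ω, u x * w x := by
  obtain ⟨hwH1, hw⟩ := hw
  have hvH1 := (hv.isDirichletTest hΩ).hasFiniteH1Norm hΩ.isOpen hΩ.isBounded
  set D : ℝ := (∫ x in Ω, inner ℝ (gradient v x) (gradient w x)) - c * ∫ x in Ω, u x * w x with hD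
  set M : ℝ := normGradL2 Ω v + c * normL2 Ω u with hM
  have hM0 : 0 ≤ M := add_nonneg (Real.sqrt_nonneg _) (mul_nonneg hc (Real.sqrt_nonneg _))
  -- The defect `D` of the weak form is zero for smooth approximants and continuous in the `H¹`
  -- norm, with constant `M`.
  have hbound : ∀ δ > 0, |D| ≤ M * δ := by
    intro δ hδ
    obtain ⟨φ, hφs, hφc, hφd, hφ⟩ := hw (δ ^ 2) (by positivity)
    have hT : IsDirichletTest Ω ΓD φ := isDirichletTest_of_hasCompactSupport hφs hφc hφd
    have hφH1 := hT.hasFiniteH1Norm hΩ.isOpen hΩ.isBounded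
    have h0 := hv.weak_form hΩ hΓ hu hT
    have e1 : ∫ x in Ω, inner ℝ (gradient v x) (gradient φ x - gradient w x) =
        (∫ x in Ω, inner ℝ (gradient v x) (gradient φ x)) -
          ∫ x in Ω, inner ℝ (gradient v x) (gradient w x) := by
      simp only [inner_sub_right]
      exact integral_sub (integrable_inner_of_memLp_two hvH1.2 hφH1.2)
        (integrable_inner_of_memLp_two hvH1.2 hwH1.2)
    have e2 : ∫ x in Ω, u x * (φ x - w x) =
        (∫ x in Ω, u x * φ x) - ∫ x in Ω, u x * w x := by
      simp only [mul_sub]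
      exact integral_sub (hu.integrable_mul hφH1.1) (hu.integrable_mul hwH1.1)
    have hDe : D = c * (∫ x in Ω, u x * (φ x - w x)) -
        ∫ x in Ω, inner ℝ (gradient v x) (gradient φ x - gradient w x) := by
      rw [e1, e2, h0, hD]
      ring
    have n1 : normL2 Ω (fun x => φ x - w x) ≤ δ := by
      refine Real.sqrt_le_iff.2 ⟨hδ.le, ?_⟩
      have : 0 ≤ ∫ x in Ω, ‖gradient φ x - gradient w x‖ ^ 2 :=
        integral_nonneg fun _ => sq_nonneg _
      linarith
    have n2 : √(∫ x in Ω, ‖gradient φ x - gradient w x‖ ^ 2) ≤ δ := by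
      refine Real.sqrt_le_iff.2 ⟨hδ.le, ?_⟩
      have : 0 ≤ ∫ x in Ω, (φ x - w x) ^ 2 := integral_nonneg fun _ => sq_nonneg _
      linarith
    have b1 : |∫ x in Ω, u x * (φ x - w x)| ≤ normL2 Ω u * δ :=
      (abs_integral_mul_le hu (hφH1.1.sub hwH1.1)).trans
        (mul_le_mul_of_nonneg_left n1 (Real.sqrt_nonneg _))
    have b2 : |∫ x in Ω, inner ℝ (gradient v x) (gradient φ x - gradient w x)| ≤
        normGradL2 Ω v * δ :=
      (abs_integral_inner_le hvH1.2 (hφH1.2.sub hwH1.2)).trans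
        (mul_le_mul_of_nonneg_left n2 (Real.sqrt_nonneg _))
    calc |D| ≤ |c * ∫ x in Ω, u x * (φ x - w x)| +
          |∫ x in Ω, inner ℝ (gradient v x) (gradient φ x - gradient w x)| := hDe ▸ abs_sub _ _
      _ ≤ c * (normL2 Ω u * δ) + normGradL2 Ω v * δ := by
          rw [abs_mul, abs_of_nonneg hc]
          gcongr
      _ = M * δ := by rw [hM]; ring
  have hD0 : D = 0 := by
    by_contra hne
    have hpos : 0 < |D| := abs_pos.2 hne
    have h1 := hbound (|D| / (M + 1)) (by positivity)
    rw [mul_div_assoc', le_div_iff₀ (by positivity)] at h1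
    nlinarith
  exact sub_eq_zero.1 hD0

/-- If the right-hand side of the iteration is itself an admissible test function, the norms
increase and the Rayleigh quotient decreases. -/
theorem IsClassicalMixedSolution.monotone_step (hΩ : IsSmoothBoundedDomain Ω)
    (hΓ : IsBoundarySplitting Ω ΓD ΓN)
    (hv : IsClassicalMixedSolution Ω ΓD ΓN (fun x => rayleigh Ω u * u x) v)
    (hu : HasFiniteH1Norm Ω u) (hu0 : 0 < normL2 Ω u) (hR : 0 < rayleigh Ω u)
    (hv0 : 0 < normL2 Ω v)
    (htest : ∫ x in Ω, inner ℝ (gradient v x) (gradient u x) =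
      rayleigh Ω u * ∫ x in Ω, u x * u x) :
    normGradL2 Ω u ≤ normGradL2 Ω v ∧ normL2 Ω u ≤ normL2 Ω v ∧
      rayleigh Ω v ≤ rayleigh Ω u := by
  have hvH1 := (hv.isDirichletTest hΩ).hasFiniteH1Norm hΩ.isOpen hΩ.isBounded
  have hen := hv.sq_normGradL2_le hΩ hΓ hR.le hu.1
  have hru := rayleigh_mul_sq_normL2 hu0
  have hrv := rayleigh_mul_sq_normL2 hv0
  have hb0 : 0 < normGradL2 Ω u := by
    have : 0 < normGradL2 Ω u ^ 2 := hru ▸ mul_pos hR (pow_pos hu0 2)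
    exact (Real.sqrt_nonneg _).lt_of_ne' fun h => by simp [normGradL2, h] at this
  have h1 : normGradL2 Ω u ≤ normGradL2 Ω v := by
    have hcs := (le_abs_self _).trans (abs_integral_inner_le hvH1.2 hu.2)
    rw [htest] at hcs
    simp only [← sq] at hcs
    rw [← sq_normL2, hru, sq] at hcs
    exact le_of_mul_le_mul_right hcs hb0
  have h2 : normL2 Ω u ≤ normL2 Ω v := by
    have h3 : normGradL2 Ω u ^ 2 ≤ normGradL2 Ω v ^ 2 := by gcongr
    -- This is the chain `R ‖u‖² = ‖∇u‖² ≤ ‖∇v‖² ≤ R ‖u‖ ‖v‖`, where `R` is the quotient of `u`.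
    have h4 : (rayleigh Ω u * normL2 Ω u) * normL2 Ω u ≤
        (rayleigh Ω u * normL2 Ω u) * normL2 Ω v := by nlinarith
    exact le_of_mul_le_mul_left h4 (mul_pos hR hu0)
  refine ⟨h1, h2, ?_⟩
  have h5 : rayleigh Ω v * normL2 Ω v ^ 2 ≤ rayleigh Ω u * normL2 Ω v ^ 2 := by
    rw [hrv, sq (normL2 Ω v)]
    refine hen.trans ?_
    gcongr
  exact le_of_mul_le_mul_right h5 (pow_pos hv0 2)

end

end

/-! ### Proof of the theorem -/

theorem mainTheorem6 {n : ℕ} (hn : 2 ≤ n)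
    (Ω ΓD ΓN : Set (EuclideanSpace ℝ (Fin n)))
    (hΩ : IsSmoothBoundedDomain Ω) (hΓ : IsBoundarySplitting Ω ΓD ΓN)
    (u : ℕ → EuclideanSpace ℝ (Fin n) → ℝ)
    (hu₀_smooth : ContDiffOn ℝ 1 (u 0) Ω)
    (hu₀_bdd : ∃ B : ℝ, ∀ x ∈ Ω, |u 0 x| ≤ B)
    (hu₀_pos : ∀ x ∈ Ω, 0 < u 0 x)
    (hu₀_energy : MemLp (gradient (u 0)) 2 (volume.restrict Ω))
    (hu₀_rayleigh : 0 < rayleigh Ω (u 0))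
    (hu : ∀ k : ℕ,
      IsClassicalMixedSolution Ω ΓD ΓN (fun x => rayleigh Ω (u k) * u k x) (u (k + 1))) :
    (∀ k : ℕ, 0 < normL2 Ω (u k)) ∧
    (∀ k : ℕ, rayleigh Ω (u (k + 1)) * normL2 Ω (u (k + 1)) ≤
      rayleigh Ω (u k) * normL2 Ω (u k)) ∧
    (∀ k : ℕ, 1 ≤ k ∨ VanishesOnDirichletPart Ω ΓD (u k) →
      normGradL2 Ω (u k) ≤ normGradL2 Ω (u (k + 1)) ∧
      normL2 Ω (u k) ≤ normL2 Ω (u (k + 1)) ∧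
      rayleigh Ω (u (k + 1)) ≤ rayleigh Ω (u k)) ∧
    (∃ M : ℝ, ∀ k : ℕ, HasFiniteH1Norm Ω (u k) ∧ normH1 Ω (u k) ≤ M) := by
  have ho := hΩ.isOpen
  have hfin : IsFiniteMeasure (volume.restrict Ω) :=
    ⟨by simpa using hΩ.isBounded.measure_lt_top⟩
  obtain ⟨x₀, hx₀⟩ := hΩ.isConnected.nonempty
  obtain ⟨B, hB⟩ := hu₀_bdd
  have hH1₀ : HasFiniteH1Norm Ω (u 0) :=
    ⟨.of_bound (hu₀_smooth.continuousOn.aestronglyMeasurable ho.measurableSet) B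
      ((ae_restrict_iff' ho.measurableSet).2 (.of_forall hB)), hu₀_energy⟩
  have hT : ∀ k, IsDirichletTest Ω ΓD (u (k + 1)) := fun k => (hu k).isDirichletTest hΩ
  have hH1 : ∀ k, HasFiniteH1Norm Ω (u k)
    | 0 => hH1₀
    | k + 1 => (hT k).hasFiniteH1Norm ho hΩ.isBounded
  -- The induction also carries a point where `u k` is non-zero: with `rayleigh > 0` it makes the
  -- next right-hand side non-trivial.
  have hpos : ∀ k, 0 < normL2 Ω (u k) ∧ 0 < rayleigh Ω (u k) ∧ ∃ x ∈ Ω, u k x ≠ 0 := by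
    intro k
    induction k with
    | zero =>
      refine ⟨Real.sqrt_pos.2 ?_, hu₀_rayleigh, x₀, hx₀, (hu₀_pos x₀ hx₀).ne'⟩
      simpa using integral_norm_sq_pos ho hu₀_smooth.continuousOn
        (by simpa using hH1₀.integrable_sq) hx₀ (hu₀_pos x₀ hx₀).ne'
    | succ k ih =>
      obtain ⟨-, hR, x, hx, hux⟩ := ih
      obtain ⟨h1, h2, h3⟩ := (hu k).norms_pos hΩ hx (mul_ne_zero hR.ne' hux)
      exact ⟨h1, div_pos (sq_normGradL2 (v := u (k + 1)) ▸ pow_pos h2 2)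
        (sq_normL2 (v := u (k + 1)) ▸ pow_pos h1 2), h3⟩
  have hdecr : ∀ k, rayleigh Ω (u (k + 1)) * normL2 Ω (u (k + 1)) ≤
      rayleigh Ω (u k) * normL2 Ω (u k) := by
    intro k
    have h := (hu k).sq_normGradL2_le hΩ hΓ (hpos k).2.1.le (hH1 k).1
    rw [← rayleigh_mul_sq_normL2 (hpos (k + 1)).1, sq, ← mul_assoc, ← mul_assoc] at h
    exact le_of_mul_le_mul_right h (hpos (k + 1)).1
  refine ⟨fun k => (hpos k).1, hdecr, fun k hk => ?_, ?_⟩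
  · refine (hu k).monotone_step hΩ hΓ (hH1 k) (hpos k).1 (hpos k).2.1 (hpos (k + 1)).1 ?_
    rcases hk with hk | hk
    · obtain ⟨j, rfl⟩ := Nat.exists_eq_add_of_le' hk
      exact (hu (j + 1)).weak_form hΩ hΓ (hH1 (j + 1)).1 (hT j)
    · exact hk.weak_form hΩ hΓ (hpos k).2.1.le (hu k) (hH1 k).1
  · obtain ⟨C, hC, hP⟩ := exists_poincare hΩ hΓ
    set D := rayleigh Ω (u 0) * normL2 Ω (u 0) with hD
    have hle : ∀ k, rayleigh Ω (u k) * normL2 Ω (u k) ≤ D := fun k =>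
      antitone_nat_of_succ_le (f := fun k => rayleigh Ω (u k) * normL2 Ω (u k)) hdecr k.zero_le
    have hD0 : 0 ≤ D := (mul_pos (hpos 0).2.1 (hpos 0).1).le
    -- The function `u 0` need not vanish on `ΓD`, so Poincaré is not available for it and its norm
    -- enters separately. For the later terms `‖v‖ ≤ C * D` and `‖∇v‖² = (R ‖v‖) ‖v‖ ≤ D * (C * D)`.
    refine ⟨max (normH1 Ω (u 0)) √((C * D) ^ 2 + D * (C * D)), fun k => ⟨hH1 k, ?_⟩⟩
    cases k with
    | zero => exact le_max_left _ _
    | succ k =>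
      refine le_trans (Real.sqrt_le_sqrt ?_) (le_max_right _ _)
      have hP' := hP _ (hT k)
      have ha := (hpos (k + 1)).1
      rw [← sq_normL2, ← sq_normGradL2, ← rayleigh_mul_sq_normL2 ha] at hP' ⊢
      have hl := hle (k + 1)
      have hbd : normL2 Ω (u (k + 1)) ≤ C * D := by
        have h1 : normL2 Ω (u (k + 1)) * normL2 Ω (u (k + 1)) ≤
            C * (rayleigh Ω (u (k + 1)) * normL2 Ω (u (k + 1))) * normL2 Ω (u (k + 1)) := by
          linarith
        exact (le_of_mul_le_mul_right h1 ha).trans (by gcongr)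
      rw [sq (normL2 Ω (u (k + 1))), ← mul_assoc, sq (C * D)]
      gcongr
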